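/- Let $V$ be a $\mathbb{Q}[\mathrm{SL}_2(\mathbb{Z})]$-module (of arbitrary dimension). Suppose that for every unipotent element $u \in \mathrm{SL}_2(\mathbb{Z})$, i.e. every $u$ such that the matrix $u - 1$ is nilpotent, one has $(u-1)^5 = 0$ in $\operatorname{End} V$. Then $V$ has a finite series of $\mathbb{Q}[\mathrm{SL}_2(\mathbb{Z})]$-submodules $0 = V_0 < V_1 < \dots < V_m = V$ such that for every $j \in \{1, \dots, m\}$ there is $k \in \{0, \dots, 4\}$ for which the factor $V_j/V_{j-1}$ is isomorphic, as a $\mathbb{Q}[\mathrm{SL}_2(\mathbb{Z})]$-module, to a (possibly infinite) direct sum of copies of $\mathbb{Q} \otimes_{\mathbb{Z}} \operatorname{Sym}^k \operatorname{Nat} \mathrm{SL}_2(\mathbb{Z})$. Here $\operatorname{Nat} \mathrm{SL}_2(\mathbb{Z})$ is $\mathbb{Z}^2$ with the natural action of $\mathrm{SL}_2(\mathbb{Z})$, and $\operatorname{Sym}^k$ is the $k$-th symmetric power over $\mathbb{Z}$. -/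

import Mathlib

open scoped TensorProduct DirectSum MatrixGroups MonoidAlgebra

noncomputable section

universe v w

namespace SL2Series

/-- Functoriality of the `k`-th symmetric power: the map induced on `Sym^k M` by an endomorphism
`f` of `M`, sending `m₁ ⋯ m_k` to `f m₁ ⋯ f m_k`. -/
def symMap {R : Type} {M : Type v} [CommRing R] [AddCommGroup M] [Module R M] (k : ℕ)
    (f : M →ₗ[R] M) : Sym[R]^k M →ₗ[R] Sym[R]^k M where
  __ := AddCon.lift (addConGen (SymmetricPower.Rel R (Fin k) M))
    ((SymmetricPower.mk R (Fin k) M ∘ₗ PiTensorProduct.map fun _ => f).toAddMonoidHom)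
    (AddCon.addConGen_le.2 (by
      rintro _ _ ⟨e, v⟩
      have h := SymmetricPower.tprod_equiv (R := R) e (fun i => f (v i))
      simpa [AddCon.ker_rel, SymmetricPower.tprod] using h.symm))
  map_smul' r x := AddCon.induction_on x fun y =>
    map_smul (SymmetricPower.mk R (Fin k) M ∘ₗ PiTensorProduct.map fun _ => f) r y

theorem symMap_tprod {R : Type} {M : Type v} [CommRing R] [AddCommGroup M] [Module R M] (k : ℕ)
    (f : M →ₗ[R] M) (v : Fin k → M) :
    symMap k f (SymmetricPower.tprod R v) = SymmetricPower.tprod R (fun i => f (v i)) := by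
  change SymmetricPower.mk R (Fin k) M
    (PiTensorProduct.map (fun _ => f) (PiTensorProduct.tprod R v)) = _
  rw [PiTensorProduct.map_tprod]
  rfl

theorem sym_ext {R : Type} {M : Type v} {N : Type w} [CommRing R] [AddCommGroup M] [Module R M]
    [AddCommGroup N] [Module R N] {k : ℕ} {f g : Sym[R]^k M →ₗ[R] N}
    (h : ∀ v : Fin k → M, f (SymmetricPower.tprod R v) = g (SymmetricPower.tprod R v)) : f = g :=
  LinearMap.ext_on_range (SymmetricPower.span_tprod_eq_top (R := R) (ι := Fin k) (M := M)) h

/-- The natural representation `Nat SL₂(R)`: the action of `SL₂(R)` on column vectors in `R²`. -/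
def natRep (R : Type) [CommRing R] : Representation R SL(2, R) (Fin 2 → R) where
  toFun g := Matrix.mulVecLin (g : Matrix (Fin 2) (Fin 2) R)
  map_one' := by simp [Module.End.one_eq_id]
  map_mul' g h := by simp [Matrix.mulVecLin_mul, Module.End.mul_eq_comp]

/-- The `k`-th symmetric power of a representation. -/
def symPow {R : Type} {G : Type w} {M : Type v} [CommRing R] [Monoid G] [AddCommGroup M]
    [Module R M] (k : ℕ) (ρ : Representation R G M) : Representation R G (Sym[R]^k M) where
  toFun g := symMap k (ρ g)
  map_one' := sym_ext fun v => by simp [symMap_tprod]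
  map_mul' g h := sym_ext fun v => by simp [symMap_tprod]

/-- Extension of scalars of a representation: `G` acts on the right-hand factor of `A ⊗ M`. -/
def extendScalars {R G M : Type*} (A : Type*) [CommRing R] [CommRing A] [Algebra R A] [Monoid G]
    [AddCommGroup M] [Module R M] (ρ : Representation R G M) :
    Representation A G (A ⊗[R] M) where
  toFun g := (ρ g).baseChange A
  map_one' := by simp [Module.End.one_eq_id]
  map_mul' g h := by simp [Module.End.mul_eq_comp, LinearMap.baseChange_comp]

/-- The representation of `SL₂(ℤ)` over `ℚ` on `ℚ ⊗ Sym^k Nat SL₂(ℤ)`. -/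
abbrev symRepQ (k : ℕ) := extendScalars ℚ (symPow k (natRep ℤ))

/-- The `ℚ[SL₂(ℤ)]`-module `ℚ ⊗ Sym^k Nat SL₂(ℤ)`. -/
abbrev SymQ (k : ℕ) : Type := (symRepQ k).asModule

/-- The `R`-module `F` is isomorphic to a direct sum of copies of the `R`-module `M`
(possibly none, possibly infinitely many). -/
def IsDirectSumOfCopies (R : Type*) [Ring R] (M : Type w) [AddCommGroup M] [Module R M]
    (F : Type v) [AddCommGroup F] [Module R F] : Prop :=
  ∃ I : Type v, Nonempty (F ≃ₗ[R] ⨁ _ : I, M)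

end SL2Series

end

noncomputable section

namespace SL2Series

open ModularGroup Polynomial

/-! The heart of the matter is a vector `x` fixed by `T`. The vector `g x` depends only on the first
column `(p, q)` of `g`, so the orbit of `x` is indexed by primitive integer vectors (`cusp`).
Conjugates of `T` satisfy the same identity `(u - 1)⁵ = 0`, which becomes a fifth-difference
relation among these vectors along lines in `ℤ²` (`cusp_relation`). Split `x` into eigenvectors of
the central element `S² = -1`. In each eigenspace finitely many such relations show that twelve
vectors span the submodule generated by `x`, with explicit formulas for `T` and `S`. Linear algebra
then exhibits layers that are images of `Sym⁰, Sym², Sym⁴, Sym²` in the even case and of `Sym¹,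
Sym³, Sym³, Sym¹` in the odd case.

To treat all of `V` at once, `symStep k W` adjoins to `W` every copy of `Sym^k` found modulo `W`.
Since `Sym^k` is simple over `ℚ[SL₂(ℤ)]`, the new factor is generated by images of one simple
module, hence is a direct sum of copies of it. The same eight steps work for every `T`-fixed vector,
and by passing to `V / W` they absorb every vector fixed modulo `W` (`mem_symTower`).

Finally, if `(T - 1)^(n+1) V ⊆ W`, then `(T - 1)^n V` is fixed by `T` modulo `W`, so the next tower
contains it. Five rounds starting from `0` reach `V`. -/

/-! ### The action of `SL₂(ℤ)`, and equivariance tested on `S` and `T` -/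

/-- The action of `SL₂(ℤ)` on a `ℚ[SL₂(ℤ)]`-module. -/
def act (V : Type*) [AddCommGroup V] [Module ℚ V] [Module (MonoidAlgebra ℚ SL(2, ℤ)) V]
    [IsScalarTower ℚ (MonoidAlgebra ℚ SL(2, ℤ)) V] : Representation ℚ SL(2, ℤ) V :=
  (Algebra.lsmul ℚ ℚ V : MonoidAlgebra ℚ SL(2, ℤ) →ₐ[ℚ] Module.End ℚ V).toMonoidHom.comp
    (MonoidAlgebra.of ℚ SL(2, ℤ))

theorem map_ratSMul {V U : Type*} [AddCommGroup V] [Module ℚ V]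
    [Module (MonoidAlgebra ℚ SL(2, ℤ)) V] [AddCommGroup U] [Module ℚ U]
    [Module (MonoidAlgebra ℚ SL(2, ℤ)) U] (f : V →ₗ[MonoidAlgebra ℚ SL(2, ℤ)] U)
    (c : ℚ) (x : V) : f (c • x) = c • f x :=
  map_rat_smul f c x

section Act

variable {V : Type*} [AddCommGroup V] [Module ℚ V] [Module (MonoidAlgebra ℚ SL(2, ℤ)) V]
  [IsScalarTower ℚ (MonoidAlgebra ℚ SL(2, ℤ)) V]

theorem act_apply (g : SL(2, ℤ)) (x : V) : act V g x = MonoidAlgebra.of ℚ SL(2, ℤ) g • x := rfl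

theorem act_mul_apply (g h : SL(2, ℤ)) (x : V) : act V (g * h) x = act V g (act V h x) := by
  rw [map_mul, Module.End.mul_apply]

theorem act_mem {W : Submodule (MonoidAlgebra ℚ SL(2, ℤ)) V} {x : V} (hx : x ∈ W)
    (g : SL(2, ℤ)) : act V g x ∈ W :=
  W.smul_mem _ hx

theorem ratSMul_mem {W : Submodule (MonoidAlgebra ℚ SL(2, ℤ)) V} {x : V} (hx : x ∈ W)
    (c : ℚ) : c • x ∈ W := by
  rw [← one_smul (MonoidAlgebra ℚ SL(2, ℤ)) x, ← smul_assoc]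
  exact W.smul_mem _ hx

theorem map_act {U : Type*} [AddCommGroup U] [Module ℚ U] [Module (MonoidAlgebra ℚ SL(2, ℤ)) U]
    [IsScalarTower ℚ (MonoidAlgebra ℚ SL(2, ℤ)) U] (f : V →ₗ[MonoidAlgebra ℚ SL(2, ℤ)] U)
    (g : SL(2, ℤ)) (x : V) : f (act V g x) = act U g (f x) :=
  map_smul f _ x

/-- A `ℚ`-linear map commuting with `S` and `T` is `ℚ[SL₂(ℤ)]`-linear. -/
theorem exists_linearMap_of_commutes {U : Type*} [AddCommGroup U] [Module ℚ U]
    [Module (MonoidAlgebra ℚ SL(2, ℤ)) U] [IsScalarTower ℚ (MonoidAlgebra ℚ SL(2, ℤ)) U]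
    (f : V →ₗ[ℚ] U) (hS : ∀ x, f (act V S x) = act U S (f x))
    (hT : ∀ x, f (act V T x) = act U T (f x)) :
    ∃ F : V →ₗ[MonoidAlgebra ℚ SL(2, ℤ)] U, ∀ x, F x = f x := by
  have key : ∀ g : SL(2, ℤ), ∀ x, f (act V g x) = act U g (f x) := by
    intro g
    have hg : g ∈ Subgroup.closure {S, T} := by
      simp [SpecialLinearGroup.SL2Z_generators]
    induction hg using Subgroup.closure_induction with
    | mem g hg =>
      rcases hg with rfl | rfl
      · exact hS
      · exact hT
    | one => simp
    | mul g h _ _ ihg ihh => intro x; simp only [act_mul_apply, ihg, ihh]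
    | inv g _ ih =>
      intro x
      have h := ih (act V g⁻¹ x)
      rw [← act_mul_apply, mul_inv_cancel, map_one, Module.End.one_apply] at h
      rw [h, ← act_mul_apply, inv_mul_cancel, map_one, Module.End.one_apply]
  exact ⟨MonoidAlgebra.equivariantOfLinearOfComm f key, fun _ => rfl⟩

/-- Modulo `N`, the vectors `m i` transform under `S` and `T` as the monomials `e₁^(k-i) e₂^i`. -/
def IsSymMod (N : Submodule (MonoidAlgebra ℚ SL(2, ℤ)) V) (k : ℕ) (m : Fin (k + 1) → V) : Prop :=
  ∀ i : Fin (k + 1),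
    act V T (m i) - ∑ j : Fin (k + 1), (Nat.choose i j : ℚ) • m j ∈ N ∧
    act V S (m i) - (-1 : ℚ) ^ (i : ℕ) • m i.rev ∈ N

theorem isSymMod_bot_iff {k : ℕ} {m : Fin (k + 1) → V} :
    IsSymMod ⊥ k m ↔ ∀ i : Fin (k + 1),
      act V T (m i) = ∑ j : Fin (k + 1), (Nat.choose i j : ℚ) • m j ∧
      act V S (m i) = (-1 : ℚ) ^ (i : ℕ) • m i.rev := by
  simp [IsSymMod, sub_eq_zero]

end Act

/-! ### Symmetric powers as spaces of polynomials of degree at most `k` -/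

/-- The map out of a symmetric power given by a symmetric multilinear map. -/
def symLift {R : Type} {M N : Type*} [CommRing R] [AddCommGroup M] [Module R M] [AddCommGroup N]
    [Module R N] {k : ℕ} (f : MultilinearMap R (fun _ : Fin k => M) N)
    (hf : ∀ (e : Equiv.Perm (Fin k)) (v : Fin k → M), f (fun i => v (e i)) = f v) :
    Sym[R]^k M →ₗ[R] N where
  __ := AddCon.lift (addConGen (SymmetricPower.Rel R (Fin k) M))
    (PiTensorProduct.lift f).toAddMonoidHom
    (AddCon.addConGen_le.2 (by
      rintro _ _ ⟨e, v⟩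
      simp [AddCon.ker_rel, hf]))
  map_smul' r x := AddCon.induction_on x fun y => map_smul (PiTensorProduct.lift f) r y

theorem symLift_tprod {R : Type} {M N : Type*} [CommRing R] [AddCommGroup M] [Module R M]
    [AddCommGroup N]
    [Module R N] {k : ℕ} (f : MultilinearMap R (fun _ : Fin k => M) N)
    (hf : ∀ (e : Equiv.Perm (Fin k)) (v : Fin k → M), f (fun i => v (e i)) = f v)
    (v : Fin k → M) : symLift f hf (SymmetricPower.tprod R v) = f v := by
  change PiTensorProduct.lift f (PiTensorProduct.tprod R v) = _
  rw [PiTensorProduct.lift.tprod]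

/-- The linear form `a e₁ + b e₂ ↦ a + b X`. -/
def dehomLinear : (Fin 2 → ℤ) →ₗ[ℤ] ℚ[X] :=
  (Pi.basisFun ℤ (Fin 2)).constr ℤ ![1, X]

theorem dehomLinear_apply (v : Fin 2 → ℤ) :
    dehomLinear v = v 0 • (1 : ℚ[X]) + v 1 • (X : ℚ[X]) := by
  simp [dehomLinear, Module.Basis.constr_apply_fintype, Fin.sum_univ_two]

/-- Dehomogenization `Sym^k ℤ² → ℚ[X]`. -/
def dehomInt (k : ℕ) :=
  symLift (R := ℤ) ((MultilinearMap.mkPiAlgebra ℤ (Fin k) ℚ[X]).compLinearMap fun _ => dehomLinear)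
    fun e v => by simpa using Equiv.prod_comp e fun i => dehomLinear (v i)

/-- Dehomogenization `ℚ ⊗ Sym^k ℤ² → ℚ[X]`. -/
def dehom (k : ℕ) : SymQ k →ₗ[ℚ] ℚ[X] :=
  ((dehomInt k).liftBaseChange ℚ).comp (symRepQ k).asModuleEquiv.toLinearMap

/-- The pure tensor `v₁ ⋯ v_k` as an element of `SymQ k`. -/
def symTensor {k : ℕ} (v : Fin k → Fin 2 → ℤ) : SymQ k :=
  (symRepQ k).asModuleEquiv.symm (1 ⊗ₜ SymmetricPower.tprod ℤ v)

theorem dehom_symTensor {k : ℕ} (v : Fin k → Fin 2 → ℤ) :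
    dehom k (symTensor v) = ∏ i, dehomLinear (v i) := by
  change (dehomInt k).liftBaseChange ℚ (1 ⊗ₜ SymmetricPower.tprod ℤ v) = _
  rw [LinearMap.liftBaseChange_tmul, one_smul, dehomInt, symLift_tprod]
  simp

theorem act_symTensor {k : ℕ} (g : SL(2, ℤ)) (v : Fin k → Fin 2 → ℤ) :
    act (SymQ k) g (symTensor v) =
      symTensor fun i => Matrix.mulVec (g : Matrix (Fin 2) (Fin 2) ℤ) (v i) := by
  rw [act_apply, symTensor, ← Representation.asModuleEquiv_symm_map_rho]
  simp [symTensor, extendScalars, symPow, natRep, symMap_tprod]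

/-- A product of standard basis vectors in `SymQ k`. -/
def symMonomial {k : ℕ} (σ : Fin k → Fin 2) : SymQ k := symTensor fun i => Pi.single (σ i) 1

theorem symQ_ext {k : ℕ} {N : Type*} [AddCommGroup N] [Module ℚ N] {f g : SymQ k →ₗ[ℚ] N}
    (h : ∀ σ : Fin k → Fin 2, f (symMonomial σ) = g (symMonomial σ)) : f = g := by
  suffices f.comp (symRepQ k).asModuleEquiv.symm.toLinearMap =
      g.comp (symRepQ k).asModuleEquiv.symm.toLinearMap by
    ext x
    simpa using LinearMap.congr_fun this ((symRepQ k).asModuleEquiv x)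
  refine TensorProduct.AlgebraTensorModule.curry_injective (LinearMap.ext_ring ?_)
  refine sym_ext fun v => ?_
  have := Module.Basis.ext_multilinear (R := ℤ) (fun _ : Fin k => Pi.basisFun ℤ (Fin 2))
    (f := ((TensorProduct.AlgebraTensorModule.curry
      (f.comp (symRepQ k).asModuleEquiv.symm.toLinearMap) 1).compMultilinearMap
        (SymmetricPower.tprod ℤ)))
    (g := ((TensorProduct.AlgebraTensorModule.curry
      (g.comp (symRepQ k).asModuleEquiv.symm.toLinearMap) 1).compMultilinearMap
        (SymmetricPower.tprod ℤ))) (fun σ => by simpa [symMonomial, symTensor] using h σ)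
  exact congrArg (fun F => F v) this

theorem dehom_symMonomial {k : ℕ} (σ : Fin k → Fin 2) :
    dehom k (symMonomial σ) = X ^ ∑ i, (σ i : ℕ) := by
  rw [symMonomial, dehom_symTensor, ← Finset.prod_pow_eq_pow_sum]
  refine Finset.prod_congr rfl fun i _ => ?_
  rw [dehomLinear_apply]
  generalize σ i = a
  fin_cases a <;> simp

theorem symTensor_comp_perm {k : ℕ} (e : Equiv.Perm (Fin k)) (v : Fin k → Fin 2 → ℤ) :
    symTensor (fun i => v (e i)) = symTensor v := by
  simp [symTensor]

/-- Equal sums mean equally large fibres over `0` and `1`, so some permutation carries `τ` to `σ`,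
and symmetric tensors do not see permutations. -/
theorem symMonomial_eq_of_sum_eq {k : ℕ} {σ τ : Fin k → Fin 2}
    (h : ∑ i, (σ i : ℕ) = ∑ i, (τ i : ℕ)) : symMonomial σ = symMonomial τ := by
  have card_one : ∀ σ : Fin k → Fin 2, Fintype.card {i // σ i = 1} = ∑ i, (σ i : ℕ) := by
    intro σ
    rw [Fintype.card_subtype, Finset.card_filter]
    refine Finset.sum_congr rfl fun i _ => ?_
    generalize σ i = a
    fin_cases a <;> simp
  have card_zero : ∀ σ : Fin k → Fin 2, Fintype.card {i // σ i = 0} = k - ∑ i, (σ i : ℕ) := by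
    intro σ
    have hc := Fintype.card_subtype_compl fun i => σ i = 1
    rw [card_one, Fintype.card_fin] at hc
    rw [← hc]
    refine Fintype.card_congr (Equiv.subtypeEquivRight fun i => ?_)
    generalize σ i = a
    fin_cases a <;> simp
  have fib : ∀ a : Fin 2, Nonempty ({i // σ i = a} ≃ {i // τ i = a}) := by
    intro a
    rw [← Fintype.card_eq]
    fin_cases a
    · exact (card_zero σ).trans ((congrArg (k - ·) h).trans (card_zero τ).symm)
    · exact (card_one σ).trans (h.trans (card_one τ).symm)
  let e : Equiv.Perm (Fin k) := Equiv.ofFiberEquiv fun a => (fib a).some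
  have he : ∀ i, τ (e i) = σ i := fun i => Equiv.ofFiberEquiv_map _ i
  rw [symMonomial, symMonomial, ← symTensor_comp_perm e fun i => Pi.single (τ i) 1]
  simp only [he]

/-- The monomial `e₁^(k-j) e₂^j` in `SymQ k`. -/
def symPower (k : ℕ) (j : ℕ) : SymQ k :=
  symMonomial fun i : Fin k => if (i : ℕ) < j then 1 else 0

theorem sum_ite_lt {k j : ℕ} (hj : j ≤ k) :
    ∑ i : Fin k, (((if (i : ℕ) < j then 1 else 0 : Fin 2) : Fin 2) : ℕ) = j := by
  rw [Fin.sum_univ_eq_sum_range (fun i => (((if i < j then 1 else 0 : Fin 2) : Fin 2) : ℕ)) k]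
  have : ∀ i, (((if i < j then 1 else 0 : Fin 2) : Fin 2) : ℕ) = if i < j then 1 else 0 := by
    intro i; split <;> rfl
  simp only [this]
  rw [← Finset.card_filter]
  have : (Finset.range k).filter (fun i => i < j) = Finset.range j := by
    ext i; simp; omega
  rw [this, Finset.card_range]

theorem sum_fin_two_le {k : ℕ} (σ : Fin k → Fin 2) : ∑ i, (σ i : ℕ) ≤ k := by
  calc ∑ i, (σ i : ℕ) ≤ ∑ _i : Fin k, 1 := Finset.sum_le_sum fun i _ => by omega
    _ = k := by simp

theorem symMonomial_eq_symPower {k : ℕ} (σ : Fin k → Fin 2) :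
    symMonomial σ = symPower k (∑ i, (σ i : ℕ)) :=
  symMonomial_eq_of_sum_eq (sum_ite_lt (sum_fin_two_le σ)).symm

theorem dehom_symPower {k j : ℕ} (hj : j ≤ k) : dehom k (symPower k j) = X ^ j := by
  rw [symPower, dehom_symMonomial, sum_ite_lt hj]

/-- A left inverse sends `X ^ j` to `symPower k j`; its values for `j > k` are irrelevant.
Injectivity lets identities in `SymQ k` be checked on polynomials, where `T` acts as `X ↦ X + 1`. -/
theorem dehom_injective (k : ℕ) : Function.Injective (dehom k) := by
  let e : ℚ[X] →ₗ[ℚ] SymQ k := (Polynomial.basisMonomials ℚ).constr ℚ (symPower k)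
  have he : ∀ j, e (X ^ j) = symPower k j := fun j => by
    simpa [X_pow_eq_monomial] using
      (Polynomial.basisMonomials ℚ).constr_basis ℚ (symPower k) j
  have : e ∘ₗ dehom k = LinearMap.id := symQ_ext fun σ => by
    rw [LinearMap.comp_apply, dehom_symMonomial, he, symMonomial_eq_symPower, LinearMap.id_apply]
  exact Function.LeftInverse.injective (g := e) fun x => LinearMap.congr_fun this x

theorem dehom_act_T {k : ℕ} (σ : Fin k → Fin 2) :
    dehom k (act (SymQ k) T (symMonomial σ)) = (X + 1) ^ ∑ i, (σ i : ℕ) := by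
  rw [symMonomial, act_symTensor, dehom_symTensor, ← Finset.prod_pow_eq_pow_sum]
  refine Finset.prod_congr rfl fun i _ => ?_
  rw [dehomLinear_apply]
  generalize σ i = a
  fin_cases a <;> simp [coe_T, add_comm]

theorem dehom_act_S {k : ℕ} (σ : Fin k → Fin 2) :
    dehom k (act (SymQ k) S (symMonomial σ)) =
      (-1 : ℚ) ^ (∑ i, (σ i : ℕ)) • X ^ (k - ∑ i, (σ i : ℕ)) := by
  have h : ∀ i, dehomLinear (Matrix.mulVec (S : Matrix (Fin 2) (Fin 2) ℤ) (Pi.single (σ i) 1)) =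
      (-1 : ℚ) ^ (σ i : ℕ) • X ^ (1 - (σ i : ℕ)) := by
    intro i
    rw [dehomLinear_apply]
    generalize σ i = a
    fin_cases a <;> simp [coe_S]
  rw [symMonomial, act_symTensor, dehom_symTensor]
  simp only [h]
  rw [Finset.prod_smul, Finset.prod_pow_eq_pow_sum, Finset.prod_pow_eq_pow_sum,
    Finset.sum_tsub_distrib _ fun i _ => by omega]
  simp

theorem act_T_symPower {k j : ℕ} (hj : j ≤ k) :
    act (SymQ k) T (symPower k j) =
      ∑ i ∈ Finset.range (j + 1), (Nat.choose j i : ℚ) • symPower k i := by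
  apply dehom_injective k
  rw [symPower, dehom_act_T, sum_ite_lt hj, add_pow, map_sum]
  refine Finset.sum_congr rfl fun i hi => ?_
  rw [map_smul, dehom_symPower (by have := Finset.mem_range.1 hi; omega), one_pow, mul_one,
    mul_comm, Polynomial.smul_eq_C_mul]
  simp

theorem act_S_symPower {k j : ℕ} (hj : j ≤ k) :
    act (SymQ k) S (symPower k j) = (-1 : ℚ) ^ j • symPower k (k - j) := by
  apply dehom_injective k
  rw [symPower, dehom_act_S, sum_ite_lt hj, map_smul, dehom_symPower (by omega)]

/-! ### Simplicity of the symmetric powers -/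

theorem symPower_zero_ne_zero (k : ℕ) : symPower k 0 ≠ 0 := by
  intro h
  have := dehom_symPower (Nat.zero_le k)
  rw [h, map_zero, pow_zero] at this
  exact zero_ne_one this

/-- The span of the monomials `e₁^(k-j) e₂^j` with `j < d`. -/
def symFlag (k d : ℕ) : Submodule ℚ (SymQ k) := Submodule.span ℚ (symPower k '' Set.Iio d)

theorem symPower_mem_symFlag {k j d : ℕ} (h : j < d) : symPower k j ∈ symFlag k d :=
  Submodule.subset_span ⟨j, h, rfl⟩

theorem symFlag_mono {k d e : ℕ} (h : d ≤ e) : symFlag k d ≤ symFlag k e :=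
  Submodule.span_mono (Set.image_mono fun _ hi => lt_of_lt_of_le hi h)

theorem symFlag_zero (k : ℕ) : symFlag k 0 = ⊥ := by
  simp [symFlag]

theorem exists_add_of_mem_symFlag_succ {k d : ℕ} {y : SymQ k} (hy : y ∈ symFlag k (d + 1)) :
    ∃ c : ℚ, ∃ r ∈ symFlag k d, y = c • symPower k d + r := by
  have : Set.Iio (d + 1) = insert d (Set.Iio d) := by ext; simp
  rw [symFlag, this, Set.image_insert_eq, Submodule.mem_span_insert] at hy
  exact hy

theorem mem_symFlag (k : ℕ) (y : SymQ k) : y ∈ symFlag k (k + 1) := by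
  have : (symFlag k (k + 1)).mkQ = 0 := symQ_ext fun σ => by
    rw [LinearMap.zero_apply, Submodule.mkQ_apply, Submodule.Quotient.mk_eq_zero,
      symMonomial_eq_symPower]
    exact symPower_mem_symFlag (by have := sum_fin_two_le σ; omega)
  exact (Submodule.Quotient.mk_eq_zero _).1 (LinearMap.congr_fun this y)

theorem act_T_symPower_succ {k d : ℕ} (hd : d + 1 ≤ k) :
    act (SymQ k) T (symPower k (d + 1)) - symPower k (d + 1) - (d + 1 : ℚ) • symPower k d ∈
      symFlag k d := by
  rw [act_T_symPower hd, Finset.sum_range_succ, Finset.sum_range_succ]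
  have : ∑ i ∈ Finset.range d, (Nat.choose (d + 1) i : ℚ) • symPower k i ∈ symFlag k d :=
    Submodule.sum_mem _ fun i hi =>
      Submodule.smul_mem _ _ (symPower_mem_symFlag (Finset.mem_range.1 hi))
  convert this using 1
  simp

theorem act_T_sub_mem_symFlag {k d : ℕ} (hd : d ≤ k) {y : SymQ k} (hy : y ∈ symFlag k (d + 1)) :
    act (SymQ k) T y - y ∈ symFlag k d := by
  have : symFlag k (d + 1) ≤ (symFlag k d).comap (act (SymQ k) T - 1) := by
    refine Submodule.span_le.2 ?_
    rintro _ ⟨j, hj, rfl⟩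
    have hj : j < d + 1 := hj
    change act (SymQ k) T (symPower k j) - symPower k j ∈ symFlag k d
    cases j with
    | zero => simp [act_T_symPower]
    | succ j =>
      have h := act_T_symPower_succ (k := k) (d := j) (by omega)
      have h2 := add_mem (symFlag_mono (by omega : j ≤ d) h)
        (Submodule.smul_mem _ ((j : ℚ) + 1) (symPower_mem_symFlag (k := k) (by omega : j < d)))
      simpa using h2
  exact this hy

/-- The operator `T - 1` lowers the degree in `e₂` by exactly one, multiplying the leading
coefficient by the old degree, which is invertible in `ℚ`. Descending gives all lower monomials;
subtracting them isolates the leading one. -/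
theorem symPower_mem_of_leading {k d : ℕ} (hd : d ≤ k)
    {N : Submodule (MonoidAlgebra ℚ SL(2, ℤ)) (SymQ k)} {c : ℚ} (hc : c ≠ 0) {r : SymQ k}
    (hr : r ∈ symFlag k d) (hy : c • symPower k d + r ∈ N) {j : ℕ} (hj : j ≤ d) :
    symPower k j ∈ N := by
  have flag_le : ∀ e, (∀ i < e, symPower k i ∈ N) → ∀ z ∈ symFlag k e, z ∈ N := by
    intro e he z hz
    induction hz using Submodule.span_induction with
    | mem z hz => obtain ⟨i, hi, rfl⟩ := hz; exact he i hi
    | zero => exact N.zero_mem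
    | add a b _ _ ha hb => exact N.add_mem ha hb
    | smul c a _ ha => exact ratSMul_mem ha c
  induction d generalizing c r j with
  | zero =>
    obtain rfl : j = 0 := by omega
    rw [symFlag_zero, Submodule.mem_bot] at hr
    rw [hr, add_zero] at hy
    simpa [smul_smul, inv_mul_cancel₀ hc] using ratSMul_mem hy c⁻¹
  | succ d ih =>
    have hlow : ∀ i < d + 1, symPower k i ∈ N := by
      intro i hi
      -- Apply the induction hypothesis to `(T - 1) y`; the chosen `r` collects its terms below
      -- degree `d`.
      refine ih (by omega) (c := c * (d + 1)) (by positivity)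
        (r := c • (act (SymQ k) T (symPower k (d + 1)) - symPower k (d + 1) -
          (d + 1 : ℚ) • symPower k d) + (act (SymQ k) T r - r))
        (add_mem (Submodule.smul_mem _ _ (act_T_symPower_succ hd))
          (act_T_sub_mem_symFlag (by omega) hr)) ?_ (by omega)
      have := sub_mem (act_mem hy T) hy
      convert this using 1
      rw [map_add, map_smul]
      module
    rcases Nat.lt_or_ge j (d + 1) with h | h
    · exact hlow j h
    · obtain rfl : j = d + 1 := by omega
      have h1 := sub_mem hy (flag_le _ hlow r hr)
      rw [add_sub_cancel_right] at h1
      simpa [smul_smul, inv_mul_cancel₀ hc] using ratSMul_mem h1 c⁻¹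

/-- From a nonzero vector, powers of `T - 1` lead down to `e₁^k`; `S` turns this into `e₂^k`, whose
descent under `T - 1` yields every monomial. -/
instance isSimpleModule_symQ (k : ℕ) : IsSimpleModule (MonoidAlgebra ℚ SL(2, ℤ)) (SymQ k) := by
  have : Nontrivial (SymQ k) := ⟨_, _, symPower_zero_ne_zero k⟩
  rw [isSimpleModule_iff]
  refine ⟨fun N => or_iff_not_imp_left.2 fun hN => ?_⟩
  obtain ⟨y, hy, hy0⟩ := N.ne_bot_iff.1 hN
  have lead : ∀ d, d ≤ k + 1 → y ∈ symFlag k d →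
      ∃ d ≤ k, ∃ c : ℚ, c ≠ 0 ∧ ∃ r ∈ symFlag k d, y = c • symPower k d + r := by
    intro d
    induction d with
    | zero =>
      intro _ h
      rw [symFlag_zero, Submodule.mem_bot] at h
      exact absurd h hy0
    | succ d ih =>
      intro hd h
      obtain ⟨c, r, hr, e⟩ := exists_add_of_mem_symFlag_succ h
      by_cases hc : c = 0
      · rw [hc, zero_smul, zero_add] at e
        exact ih (by omega) (e ▸ hr)
      · exact ⟨d, by omega, c, hc, r, hr, e⟩
  obtain ⟨d, hd, c, hc, r, hr, rfl⟩ := lead _ le_rfl (mem_symFlag k y)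
  have h0 := symPower_mem_of_leading hd hc hr hy (Nat.zero_le d)
  have hk : symPower k k ∈ N := by
    have := act_mem h0 S
    rwa [act_S_symPower (Nat.zero_le k), pow_zero, one_smul, Nat.sub_zero] at this
  have hall : ∀ j ≤ k, symPower k j ∈ N := fun j hj =>
    symPower_mem_of_leading le_rfl one_ne_zero (zero_mem _) (by simpa using hk) hj
  refine eq_top_iff.2 fun z _ => ?_
  have hz := mem_symFlag k z
  induction hz using Submodule.span_induction with
  | mem z hz =>
    obtain ⟨i, hi, rfl⟩ := hz
    exact hall i (Nat.lt_succ_iff.1 hi)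
  | zero => exact N.zero_mem
  | add a b _ _ ha hb => exact N.add_mem (ha trivial) (hb trivial)
  | smul c a _ ha => exact ratSMul_mem (ha trivial) c

/-! ### Homomorphisms out of `SymQ k` and isotypic modules -/

section

variable {V : Type*} [AddCommGroup V] [Module ℚ V] [Module (MonoidAlgebra ℚ SL(2, ℤ)) V]
  [IsScalarTower ℚ (MonoidAlgebra ℚ SL(2, ℤ)) V]

/-- A tuple transforming as the monomials is the image of the monomials under a homomorphism
from `SymQ k`. -/
theorem exists_linearMap_of_isSymMod_bot {k : ℕ} {m : Fin (k + 1) → V} (hm : IsSymMod ⊥ k m) :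
    ∃ F : SymQ k →ₗ[MonoidAlgebra ℚ SL(2, ℤ)] V, ∀ j : Fin (k + 1), F (symPower k j) = m j := by
  rw [isSymMod_bot_iff] at hm
  -- The value `0` beyond degree `k` is a default: `dehom k` never reaches those degrees.
  let L : ℚ[X] →ₗ[ℚ] V := (Polynomial.basisMonomials ℚ).constr ℚ
    fun j => if h : j < k + 1 then m ⟨j, h⟩ else 0
  have hL : ∀ j : Fin (k + 1), L (X ^ (j : ℕ)) = m j := fun j => by
    have h := (Polynomial.basisMonomials ℚ).constr_basis ℚ
      (fun j => if h : j < k + 1 then m ⟨j, h⟩ else 0) (j : ℕ)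
    rw [dif_pos j.2, Polynomial.coe_basisMonomials] at h
    rw [X_pow_eq_monomial]
    exact h
  have hF : ∀ j : Fin (k + 1), L (dehom k (symPower k j)) = m j := fun j => by
    rw [dehom_symPower (Nat.lt_succ_iff.1 j.2), hL]
  have hS : (L ∘ₗ dehom k) ∘ₗ act (SymQ k) S = act V S ∘ₗ (L ∘ₗ dehom k) := by
    refine symQ_ext fun σ => ?_
    obtain ⟨j, hj⟩ : ∃ j : Fin (k + 1), (j : ℕ) = ∑ i, (σ i : ℕ) :=
      ⟨⟨_, Nat.lt_succ_iff.2 (sum_fin_two_le σ)⟩, rfl⟩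
    have hr : k - (j : ℕ) = (j.rev : ℕ) := by rw [Fin.val_rev]; omega
    simp only [LinearMap.comp_apply]
    rw [symMonomial_eq_symPower, ← hj, act_S_symPower (Nat.lt_succ_iff.1 j.2), hF, map_smul,
      map_smul, hr, hF, (hm j).2]
  have hT : (L ∘ₗ dehom k) ∘ₗ act (SymQ k) T = act V T ∘ₗ (L ∘ₗ dehom k) := by
    refine symQ_ext fun σ => ?_
    obtain ⟨j, hj⟩ : ∃ j : Fin (k + 1), (j : ℕ) = ∑ i, (σ i : ℕ) :=
      ⟨⟨_, Nat.lt_succ_iff.2 (sum_fin_two_le σ)⟩, rfl⟩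
    have hsum : act (SymQ k) T (symPower k j) =
        ∑ i : Fin (k + 1), (Nat.choose j i : ℚ) • symPower k i := by
      rw [act_T_symPower (Nat.lt_succ_iff.1 j.2),
        Fin.sum_univ_eq_sum_range (fun i => (Nat.choose j i : ℚ) • symPower k i) (k + 1)]
      refine Finset.sum_subset (Finset.range_subset_range.2 j.2) fun i _ hi => ?_
      rw [Nat.choose_eq_zero_of_lt (by simpa using hi), Nat.cast_zero, zero_smul]
    simp only [LinearMap.comp_apply]
    rw [symMonomial_eq_symPower, ← hj, hsum, hF, (hm j).1]
    simp only [map_sum, map_smul, hF]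
  obtain ⟨F, hF'⟩ := exists_linearMap_of_commutes (L ∘ₗ dehom k)
    (LinearMap.congr_fun hS) (LinearMap.congr_fun hT)
  exact ⟨F, fun j => (hF' _).trans (hF j)⟩

end

/-- A module generated by homomorphic images of a simple module is a direct sum of copies of it. -/
theorem isDirectSumOfCopies_of_span_eq_top {R S M : Type*} [Ring R] [AddCommGroup S] [Module R S]
    [IsSimpleModule R S] [AddCommGroup M] [Module R M] {X : Set M} (hX : Submodule.span R X = ⊤)
    (h : ∀ x ∈ X, ∃ f : S →ₗ[R] M, x ∈ LinearMap.range f) : IsDirectSumOfCopies R S M := by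
  have htop : isotypicComponent R M S = ⊤ := by
    rw [eq_top_iff, ← hX, Submodule.span_le]
    intro x hx
    obtain ⟨f, y, rfl⟩ := h x hx
    -- `S` is its own isotypic component, and homomorphisms map isotypic components into isotypic
    -- components.
    have hy : y ∈ isotypicComponent R S S :=
      (le_sSup (show (⊤ : Submodule R S) ∈ {m : Submodule R S | Nonempty (m ≃ₗ[R] S)} from
        ⟨Submodule.topEquiv⟩)) Submodule.mem_top
    exact LinearMap.le_comap_isotypicComponent S f hy
  have hss : IsSemisimpleModule R M := by
    have : IsSemisimpleModule R (isotypicComponent R M S) := inferInstance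
    rw [htop] at this
    exact IsSemisimpleModule.congr Submodule.topEquiv.symm
  obtain ⟨ι, ⟨e⟩⟩ := (IsIsotypicOfType.of_isotypicComponent_eq_top htop).linearEquiv_finsupp
  classical exact ⟨ι, ⟨e.trans (finsuppLEquivDirectSum R S ι)⟩⟩

/-! ### Adjoining all copies of `Sym^k` modulo a submodule -/

section

variable {V : Type*} [AddCommGroup V] [Module ℚ V] [Module (MonoidAlgebra ℚ SL(2, ℤ)) V]
  [IsScalarTower ℚ (MonoidAlgebra ℚ SL(2, ℤ)) V]

theorem isSymMod_comap_iff {U : Type*} [AddCommGroup U] [Module ℚ U]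
    [Module (MonoidAlgebra ℚ SL(2, ℤ)) U] [IsScalarTower ℚ (MonoidAlgebra ℚ SL(2, ℤ)) U]
    (f : V →ₗ[MonoidAlgebra ℚ SL(2, ℤ)] U) (N : Submodule (MonoidAlgebra ℚ SL(2, ℤ)) U) {k : ℕ}
    (m : Fin (k + 1) → V) :
    IsSymMod (N.comap f) k m ↔ IsSymMod N k fun i => f (m i) := by
  simp only [IsSymMod, Submodule.mem_comap, map_sub, map_sum, map_act, map_ratSMul]

theorem IsSymMod.mono {N N' : Submodule (MonoidAlgebra ℚ SL(2, ℤ)) V} (h : N ≤ N') {k : ℕ}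
    {m : Fin (k + 1) → V} (hm : IsSymMod N k m) : IsSymMod N' k m :=
  fun i => ⟨h (hm i).1, h (hm i).2⟩

/-- The submodule generated by `W` and all tuples transforming modulo `W` as the monomials of
degree `k`. -/
def symStep (k : ℕ) (W : Submodule (MonoidAlgebra ℚ SL(2, ℤ)) V) :
    Submodule (MonoidAlgebra ℚ SL(2, ℤ)) V :=
  W ⊔ Submodule.span _ {x | ∃ m : Fin (k + 1) → V, IsSymMod W k m ∧ ∃ i, m i = x}

theorem le_symStep (k : ℕ) (W : Submodule (MonoidAlgebra ℚ SL(2, ℤ)) V) : W ≤ symStep k W :=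
  le_sup_left

theorem IsSymMod.mem_symStep {k : ℕ} {W : Submodule (MonoidAlgebra ℚ SL(2, ℤ)) V}
    {m : Fin (k + 1) → V} (hm : IsSymMod W k m) (i : Fin (k + 1)) : m i ∈ symStep k W :=
  le_sup_right (a := W) (Submodule.subset_span ⟨m, hm, i, rfl⟩)

/-- A tuple modulo `N` lifts along the surjection `f` to a tuple modulo `N.comap f`. This transports
a tower built in a quotient back to `V`. -/
theorem comap_symStep_le {U : Type*} [AddCommGroup U] [Module ℚ U]
    [Module (MonoidAlgebra ℚ SL(2, ℤ)) U] [IsScalarTower ℚ (MonoidAlgebra ℚ SL(2, ℤ)) U]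
    {f : V →ₗ[MonoidAlgebra ℚ SL(2, ℤ)] U} (hf : Function.Surjective f) {k : ℕ}
    {N : Submodule (MonoidAlgebra ℚ SL(2, ℤ)) U} {W : Submodule (MonoidAlgebra ℚ SL(2, ℤ)) V}
    (h : N.comap f ≤ W) : (symStep k N).comap f ≤ symStep k W := by
  have hmap : symStep k N ≤ (symStep k W).map f := by
    refine sup_le ?_ (Submodule.span_le.2 ?_)
    · intro y hy
      obtain ⟨x, rfl⟩ := hf y
      exact ⟨x, le_symStep k W (h hy), rfl⟩
    · rintro _ ⟨m, hm, i, rfl⟩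
      choose g hg using hf
      refine ⟨g (m i), ?_, hg _⟩
      have hgm : IsSymMod (N.comap f) k fun i => g (m i) := by
        rw [isSymMod_comap_iff]
        simpa only [hg] using hm
      exact (hgm.mono h).mem_symStep i
  intro x hx
  obtain ⟨z, hz, hzx⟩ := hmap hx
  have : z - x ∈ symStep k W := le_symStep k W (h (by simp [hzx]))
  simpa using sub_mem hz this

/-- In the quotient each adjoined tuple satisfies the monomial formulas exactly, so it lies in the
image of the simple module `SymQ k`; these images generate. -/
theorem isDirectSumOfCopies_symStep (k : ℕ) (W : Submodule (MonoidAlgebra ℚ SL(2, ℤ)) V) :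
    IsDirectSumOfCopies (MonoidAlgebra ℚ SL(2, ℤ)) (SymQ k)
      (symStep k W ⧸ W.submoduleOf (symStep k W)) := by
  let X : Set (symStep k W ⧸ W.submoduleOf (symStep k W)) :=
    {x | ∃ m : Fin (k + 1) → symStep k W,
      IsSymMod (W.submoduleOf (symStep k W)) k m ∧ ∃ i, Submodule.mkQ _ (m i) = x}
  refine isDirectSumOfCopies_of_span_eq_top (X := X) ?_ ?_
  · have hle : symStep k W ≤ ((Submodule.span (MonoidAlgebra ℚ SL(2, ℤ)) X).comap
        (W.submoduleOf (symStep k W)).mkQ).map (symStep k W).subtype := by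
      refine sup_le ?_ (Submodule.span_le.2 ?_)
      · intro w hw
        refine ⟨⟨w, le_symStep k W hw⟩, ?_, rfl⟩
        have : (W.submoduleOf (symStep k W)).mkQ ⟨w, le_symStep k W hw⟩ = 0 :=
          (Submodule.Quotient.mk_eq_zero _).2 hw
        rw [SetLike.mem_coe, Submodule.mem_comap, this]
        exact zero_mem _
      · rintro _ ⟨m, hm, i, rfl⟩
        refine ⟨⟨m i, hm.mem_symStep i⟩, Submodule.subset_span ?_, rfl⟩
        exact ⟨fun i => ⟨m i, hm.mem_symStep i⟩,
          (isSymMod_comap_iff (symStep k W).subtype W _).2 hm, i, rfl⟩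
    refine eq_top_iff.2 fun y _ => ?_
    obtain ⟨w, rfl⟩ := Submodule.mkQ_surjective _ y
    obtain ⟨w', hw', e⟩ := hle w.2
    rw [← Subtype.ext (a1 := w') (a2 := w) e]
    exact hw'
  · rintro _ ⟨m, hm, i, rfl⟩
    have : IsSymMod ⊥ k fun i => (W.submoduleOf (symStep k W)).mkQ (m i) := by
      rw [← isSymMod_comap_iff]
      simpa using hm
    obtain ⟨F, hF⟩ := exists_linearMap_of_isSymMod_bot this
    exact ⟨F, symPower k i, hF i⟩

end

/-! ### From chains of factors to indexed series -/

/-- `W < W'` and `W' / W` is a direct sum of copies of some `SymQ k` with `k ≤ 4`. -/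
def IsSymFactor {V : Type*} [AddCommGroup V] [Module (MonoidAlgebra ℚ SL(2, ℤ)) V]
    (W W' : Submodule (MonoidAlgebra ℚ SL(2, ℤ)) V) : Prop :=
  W < W' ∧ ∃ k : ℕ, k ≤ 4 ∧
    IsDirectSumOfCopies (MonoidAlgebra ℚ SL(2, ℤ)) (SymQ k) (W' ⧸ W.submoduleOf W')

theorem exists_series_of_reflTransGen {V : Type*} [AddCommGroup V]
    [Module (MonoidAlgebra ℚ SL(2, ℤ)) V] {W W' : Submodule (MonoidAlgebra ℚ SL(2, ℤ)) V}
    (h : Relation.ReflTransGen IsSymFactor W W') :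
    ∃ (m : ℕ) (U : Fin (m + 1) → Submodule (MonoidAlgebra ℚ SL(2, ℤ)) V),
      U 0 = W ∧ U (Fin.last m) = W' ∧ ∀ j : Fin m, IsSymFactor (U j.castSucc) (U j.succ) := by
  induction h with
  | refl => exact ⟨0, fun _ => W, rfl, rfl, fun j => j.elim0⟩
  | @tail B C _ hBC ih =>
    obtain ⟨m, U, h0, h1, hU⟩ := ih
    refine ⟨m + 1, Fin.snoc U C, ?_, Fin.snoc_last .., fun j => ?_⟩
    · rw [← Fin.castSucc_zero, Fin.snoc_castSucc, h0]
    · refine Fin.lastCases ?_ (fun i => ?_) j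
      · rw [Fin.succ_last, Fin.snoc_last, Fin.snoc_castSucc, h1]
        exact hBC
      · rw [← Fin.castSucc_succ, Fin.snoc_castSucc, Fin.snoc_castSucc]
        exact hU i

/-- A step that adds nothing is dropped, which keeps the final series strict. -/
theorem reflTransGen_symStep {V : Type*} [AddCommGroup V] [Module ℚ V]
    [Module (MonoidAlgebra ℚ SL(2, ℤ)) V] [IsScalarTower ℚ (MonoidAlgebra ℚ SL(2, ℤ)) V]
    {k : ℕ} (hk : k ≤ 4) {W W' : Submodule (MonoidAlgebra ℚ SL(2, ℤ)) V}
    (h : Relation.ReflTransGen IsSymFactor W W') :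
    Relation.ReflTransGen IsSymFactor W (symStep k W') := by
  rcases (le_symStep k W').eq_or_lt with e | e
  · rwa [← e]
  · exact h.tail ⟨e, k, hk, isDirectSumOfCopies_symStep k W'⟩

/-! ### Vectors indexed by primitive columns, and their relations -/

section

variable {V : Type*} [AddCommGroup V] [Module ℚ V] [Module (MonoidAlgebra ℚ SL(2, ℤ)) V]
  [IsScalarTower ℚ (MonoidAlgebra ℚ SL(2, ℤ)) V]

open Classical in
/-- The vector `g x`, where `g ∈ SL₂(ℤ)` has first column `(p, q)`; zero if `p` and `q` are not
coprime. -/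
def cusp (x : V) (p q : ℤ) : V :=
  if h : IsCoprime p q then act V (h.exists_SL2_col 0).choose x else 0

theorem act_zpow_eq_self {x : V} {g : SL(2, ℤ)} (hx : act V g x = x) (n : ℤ) :
    act V (g ^ n) x = x := by
  have : ∀ n : ℕ, act V (g ^ n) x = x := fun n => by
    induction n with
    | zero => simp
    | succ n ih => rw [pow_succ, act_mul_apply, hx, ih]
  obtain ⟨n, rfl | rfl⟩ := n.eq_nat_or_neg
  · rw [zpow_natCast, this]
  · nth_rw 1 [← this n]
    rw [← act_mul_apply, zpow_neg, zpow_natCast, inv_mul_cancel, map_one, Module.End.one_apply]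

theorem eq_mul_T_zpow {g h : SL(2, ℤ)} (h0 : g 0 0 = h 0 0) (h1 : g 1 0 = h 1 0) :
    ∃ n : ℤ, g = h * T ^ n := by
  -- The matrix `h⁻¹ g` fixes the first basis vector, so it is a power of `T`; the exponent is its
  -- upper right entry.
  refine ⟨h 1 1 * g 0 1 - h 0 1 * g 1 1, ?_⟩
  have hg := g.det_coe
  have hh := h.det_coe
  rw [Matrix.det_fin_two] at hg hh
  ext i j
  rw [Matrix.SpecialLinearGroup.coe_mul, coe_T_zpow]
  fin_cases i <;> fin_cases j <;> simp [Matrix.mul_apply, Fin.sum_univ_two]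
  · exact h0
  · rw [h0, h1] at hg
    linear_combination (-(g 0 1)) * hh + (h 0 1) * hg
  · exact h1
  · rw [h0, h1] at hg
    linear_combination (-(g 1 1)) * hh + (h 1 1) * hg

theorem act_eq_cusp {x : V} (hx : act V T x = x) (g : SL(2, ℤ)) :
    act V g x = cusp x (g 0 0) (g 1 0) := by
  have hs := ((g.isCoprime_col 0).exists_SL2_col 0).choose_spec
  rw [cusp, dif_pos (g.isCoprime_col 0)]
  obtain ⟨n, hn⟩ := eq_mul_T_zpow hs.1.symm hs.2.symm
  nth_rw 1 [hn]
  rw [act_mul_apply, act_zpow_eq_self hx]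

/-- Invertible matrices preserve coprimality, so with the default value `0` the formula holds for
all integers `p, q`. -/
theorem act_cusp {x : V} (hx : act V T x = x) (g : SL(2, ℤ)) (p q : ℤ) :
    act V g (cusp x p q) = cusp x (g 0 0 * p + g 0 1 * q) (g 1 0 * p + g 1 1 * q) := by
  by_cases h : IsCoprime p q
  · obtain ⟨γ, rfl, rfl⟩ := h.exists_SL2_col 0
    rw [← act_eq_cusp hx, ← act_mul_apply, act_eq_cusp hx]
    simp [Matrix.mul_apply, Fin.sum_univ_two]
  · have h' : ¬ IsCoprime (g 0 0 * p + g 0 1 * q) (g 1 0 * p + g 1 1 * q) := by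
      rintro ⟨a, b, hab⟩
      exact h ⟨a * g 0 0 + b * g 1 0, a * g 0 1 + b * g 1 1, by linear_combination hab⟩
    rw [cusp, cusp, dif_neg h, dif_neg h', map_zero]

theorem cusp_one_zero {x : V} (hx : act V T x = x) : cusp x 1 0 = x := by
  simpa using (act_eq_cusp hx 1).symm

theorem act_T_cusp {x : V} (hx : act V T x = x) (p q : ℤ) :
    act V T (cusp x p q) = cusp x (p + q) q := by
  rw [act_cusp hx]
  simp [coe_T]

theorem act_S_cusp {x : V} (hx : act V T x = x) (p q : ℤ) :
    act V S (cusp x p q) = cusp x (-q) p := by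
  rw [act_cusp hx]
  simp [coe_S]

theorem cusp_neg {x : V} (hx : act V T x = x) {ε : ℚ} (hε : act V S (act V S x) = ε • x)
    (p q : ℤ) : cusp x (-p) (-q) = ε • cusp x p q := by
  rw [← act_S_cusp hx, ← act_S_cusp hx]
  by_cases h : IsCoprime p q
  · obtain ⟨γ, rfl, rfl⟩ := h.exists_SL2_col 0
    -- `S²` is the scalar matrix `-1`, so its eigenvalue on `x` persists along the whole orbit.
    have hc : S * S * γ = γ * (S * S) := by
      ext i j
      fin_cases i <;> fin_cases j <;> simp [coe_S, Matrix.mul_apply,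
        Fin.sum_univ_two]
    rw [← act_eq_cusp hx, ← act_mul_apply, ← act_mul_apply, hc, act_mul_apply, act_mul_apply, hε,
      map_smul]
  · rw [cusp, dif_neg h]
    simp

/-- The identity `(u - 1)⁵ = 0` for the unipotent `u` fixing `(r, s)`, applied to a cusp vector. -/
theorem cusp_relation {x : V} (hx : act V T x = x) (h5 : ∀ y : V, ((act V T - 1 : Module.End ℚ V) ^
    5) y = 0)
    (r s t w : ℤ) (hdet : r * w - t * s = 1) (a b : ℤ) :
    cusp x (r * (a + 5 * b) + t * b) (s * (a + 5 * b) + w * b)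
      - (5 : ℚ) • cusp x (r * (a + 4 * b) + t * b) (s * (a + 4 * b) + w * b)
      + (10 : ℚ) • cusp x (r * (a + 3 * b) + t * b) (s * (a + 3 * b) + w * b)
      - (10 : ℚ) • cusp x (r * (a + 2 * b) + t * b) (s * (a + 2 * b) + w * b)
      + (5 : ℚ) • cusp x (r * (a + b) + t * b) (s * (a + b) + w * b)
      - cusp x (r * a + t * b) (s * a + w * b) = 0 := by
  let g : SL(2, ℤ) := ⟨!![r, t; s, w], by rw [Matrix.det_fin_two_of, hdet]⟩
  have hg : ∀ p q : ℤ, act V g (cusp x p q) = cusp x (r * p + t * q) (s * p + w * q) := fun p q =>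
    act_cusp hx g p q
  -- Powers of `T` move `(a, b)` through `(a + i b, b)`; expanding the fifth power gives binomial
  -- coefficients, and `g` carries this line to one with direction `(r, s)`.
  have h := congrArg (act V g) (h5 (cusp x a b))
  simp only [pow_succ, pow_zero, one_mul, Module.End.mul_apply, LinearMap.sub_apply,
    Module.End.one_apply, map_sub, act_T_cusp hx, hg, map_zero] at h
  have e2 : a + b + b = a + 2 * b := by ring
  have e3 : a + 2 * b + b = a + 3 * b := by ring
  have e4 : a + 3 * b + b = a + 4 * b := by ring
  have e5 : a + 4 * b + b = a + 5 * b := by ring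
  rw [e2, e3, e4, e5] at h
  rw [← h]
  module

/-- The relations between the vectors `cusp x p q` that reduce everything to twelve of them. -/
theorem cusp_relations {x : V} (hx : act V T x = x) {ε : ℚ} (hε : act V S (act V S x) = ε • x)
    (h5 : ∀ y : V, ((act V T - 1 : Module.End ℚ V) ^ 5) y = 0) :
    cusp x 3 1 - (5 : ℚ) • cusp x 2 1 + (10 : ℚ) • cusp x 1 1 - (10 : ℚ) • cusp x 0 1 + (5 : ℚ) •
        cusp x (-1) 1 - cusp x (-2) 1 = 0 ∧
    ε • cusp x (-1) 2 - (5 : ℚ) • ε • cusp x (-1) 1 + (10 : ℚ) • cusp x 1 0 - (10 : ℚ) • cusp x 1 1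
        + (5 : ℚ) • cusp x 1 2 - cusp x 1 3 = 0 ∧
    cusp x 2 3 - (5 : ℚ) • cusp x 1 2 + (10 : ℚ) • cusp x 0 1 - (10 : ℚ) • ε • cusp x 1 0 + (5 : ℚ)
        • ε • cusp x 2 1 - ε • cusp x 3 2 = 0 ∧
    cusp x (-3) 2 - (5 : ℚ) • cusp x (-2) 1 + (10 : ℚ) • ε • cusp x 1 0 - (10 : ℚ) • ε • cusp x 0 1
        + (5 : ℚ) • ε • cusp x (-1) 2 - ε • cusp x (-2) 3 = 0 ∧
    cusp x 5 3 - (5 : ℚ) • cusp x 3 2 + (10 : ℚ) • cusp x 1 1 - (10 : ℚ) • ε • cusp x 1 0 + (5 : ℚ)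
        • ε • cusp x 3 1 - ε • cusp x 5 2 = 0 ∧
    cusp x 7 2 - (5 : ℚ) • cusp x 5 2 + (10 : ℚ) • cusp x 3 2 - (10 : ℚ) • cusp x 1 2 + (5 : ℚ) •
        cusp x (-1) 2 - cusp x (-3) 2 = 0 ∧
    cusp x 2 5 - (5 : ℚ) • cusp x 1 3 + (10 : ℚ) • cusp x 0 1 - (10 : ℚ) • ε • cusp x 1 1 + (5 : ℚ)
        • ε • cusp x 2 3 - ε • cusp x 3 5 = 0 ∧
    cusp x (-2) 5 - (5 : ℚ) • cusp x (-2) 3 + (10 : ℚ) • cusp x (-2) 1 - (10 : ℚ) • ε • cusp x 2 1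
        + (5 : ℚ) • ε • cusp x 2 3 - ε • cusp x 2 5 = 0 := by
  -- Opposite columns differ by the factor `ε`; these equalities fix one representative of each
  -- pair.
  have nm23 : cusp x 2 (-3) = ε • cusp x (-2) 3 := by
    simpa only [neg_neg, neg_zero] using cusp_neg hx hε (-2) 3
  have nm11 : cusp x 1 (-1) = ε • cusp x (-1) 1 := by
    simpa only [neg_neg, neg_zero] using cusp_neg hx hε (-1) 1
  have nm12 : cusp x 1 (-2) = ε • cusp x (-1) 2 := by
    simpa only [neg_neg, neg_zero] using cusp_neg hx hε (-1) 2
  have n01 : cusp x 0 (-1) = ε • cusp x 0 1 := by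
    simpa only [neg_neg, neg_zero] using cusp_neg hx hε 0 1
  have n10 : cusp x (-1) 0 = ε • cusp x 1 0 := by
    simpa only [neg_neg, neg_zero] using cusp_neg hx hε 1 0
  have n11 : cusp x (-1) (-1) = ε • cusp x 1 1 := by
    simpa only [neg_neg, neg_zero] using cusp_neg hx hε 1 1
  have n21 : cusp x (-2) (-1) = ε • cusp x 2 1 := by
    simpa only [neg_neg, neg_zero] using cusp_neg hx hε 2 1
  have n23 : cusp x (-2) (-3) = ε • cusp x 2 3 := by
    simpa only [neg_neg, neg_zero] using cusp_neg hx hε 2 3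
  have n25 : cusp x (-2) (-5) = ε • cusp x 2 5 := by
    simpa only [neg_neg, neg_zero] using cusp_neg hx hε 2 5
  have n31 : cusp x (-3) (-1) = ε • cusp x 3 1 := by
    simpa only [neg_neg, neg_zero] using cusp_neg hx hε 3 1
  have n32 : cusp x (-3) (-2) = ε • cusp x 3 2 := by
    simpa only [neg_neg, neg_zero] using cusp_neg hx hε 3 2
  have n35 : cusp x (-3) (-5) = ε • cusp x 3 5 := by
    simpa only [neg_neg, neg_zero] using cusp_neg hx hε 3 5
  have n52 : cusp x (-5) (-2) = ε • cusp x 5 2 := by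
    simpa only [neg_neg, neg_zero] using cusp_neg hx hε 5 2
  refine ⟨?_, ?_, ?_, ?_, ?_, ?_, ?_, ?_⟩
  · have h := cusp_relation hx h5 1 0 0 1 (by norm_num) (-2) 1
    norm_num1 at h
    exact h
  · have h := cusp_relation hx h5 0 1 (-1) 0 (by norm_num) 3 (-1)
    norm_num1 at h
    rwa [nm11, nm12] at h
  · have h := cusp_relation hx h5 1 1 0 1 (by norm_num) (-3) 1
    norm_num1 at h
    rwa [n10, n21, n32] at h
  · have h := cusp_relation hx h5 (-1) 1 (-1) 0 (by norm_num) (-3) 1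
    norm_num1 at h
    rwa [nm23, nm12, n01, n10] at h
  · have h := cusp_relation hx h5 2 1 1 1 (by norm_num) (-3) 1
    norm_num1 at h
    rwa [n10, n31, n52] at h
  · have h := cusp_relation hx h5 1 0 0 1 (by norm_num) (-3) 2
    norm_num1 at h
    exact h
  · have h := cusp_relation hx h5 1 2 0 1 (by norm_num) (-3) 1
    norm_num1 at h
    rwa [n11, n23, n35] at h
  · have h := cusp_relation hx h5 0 1 (-1) 0 (by norm_num) (-5) 2
    norm_num1 at h
    rwa [n21, n23, n25] at h

/-- Twelve vectors spanning the submodule generated by a vector fixed by `T` and `S²`. -/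
theorem exists_even_basis {x : V} (hx : act V T x = x) (hε : act V S (act V S x) = (1 : ℚ) • x)
    (h5 : ∀ y : V, ((act V T - 1 : Module.End ℚ V) ^ 5) y = 0) :
    ∃ e0 e1 e2 e3 e4 e5 e6 e7 e8 e9 e10 e11 : V, e0 = x ∧
      act V T e0 = e0 ∧
      act V T e1 = e2 ∧
      act V T e2 = e4 ∧
      act V T e3 = e1 ∧
      act V T e4 = (10 : ℚ) • e1 - (10 : ℚ) • e2 - (5 : ℚ) • e3 + (5 : ℚ) • e4 + e7 ∧
      act V T e5 = e6 ∧
      act V T e6 = -(10 : ℚ) • e0 + (10 : ℚ) • e1 + (5 : ℚ) • e4 - (5 : ℚ) • e6 + e8 ∧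
      act V T e7 = e3 ∧
      act V T e8 = -(40 : ℚ) • e0 + (40 : ℚ) • e2 + (25 : ℚ) • e3 - (25 : ℚ) • e6 - (5 : ℚ) • e7 +
          (5 : ℚ) • e8 + e10 ∧
      act V T e9 = e5 ∧
      act V T e10 = (100 : ℚ) • e0 - (100 : ℚ) • e1 - (50 : ℚ) • e4 - (5 : ℚ) • e5 + (60 : ℚ) • e6
          - (10 : ℚ) • e8 + e9 + (5 : ℚ) • e10 ∧
      act V T e11 = -(100 : ℚ) • e0 + (60 : ℚ) • e1 + (40 : ℚ) • e2 + (25 : ℚ) • e3 - (10 : ℚ) • e4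
          - (30 : ℚ) • e5 - (25 : ℚ) • e6 + (35 : ℚ) • e7 + (10 : ℚ) • e8 - (5 : ℚ) • e9 + e11 ∧
      act V S e0 = e1 ∧
      act V S e1 = e0 ∧
      act V S e2 = e3 ∧
      act V S e3 = e2 ∧
      act V S e4 = e5 ∧
      act V S e5 = e4 ∧
      act V S e6 = e7 ∧
      act V S e7 = e6 ∧
      act V S e8 = e9 ∧
      act V S e9 = e8 ∧
      act V S e10 = e11 ∧
      act V S e11 = e10 := by
  obtain ⟨h31, h13, h32, h23, h53, h72, h25, h25b⟩ := cusp_relations hx hε h5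
  have hT := act_T_cusp hx
  have hS := act_S_cusp hx
  have hn := cusp_neg hx hε
  -- The list consists of six pairs interchanged by `S` up to sign. `T` leaves the list only at
  -- `(2,1)`, `(1,2)`, `(2,3)`, `(5,2)` and `(-2,5)`, where the fifth-difference relations are used
  -- to return.
  refine ⟨cusp x 1 0, cusp x 0 1, cusp x 1 1, cusp x (-1) 1, cusp x 2 1, cusp x (-1) 2, cusp x 1 2,
      cusp x (-2) 1, cusp x 2 3, cusp x (-3) 2, cusp x 5 2, cusp x (-2) 5, cusp_one_zero hx,
    ?_, ?_, ?_, ?_, ?_, ?_, ?_, ?_, ?_, ?_, ?_, ?_, ?_, ?_, ?_, ?_, ?_, ?_, ?_, ?_, ?_, ?_, ?_, ?_⟩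
  · exact hT 1 0
  · exact hT 0 1
  · exact hT 1 1
  · exact hT (-1) 1
  · refine (hT 2 1).trans ?_
    norm_num1
    linear_combination (norm := module) (1 : ℚ) • h31
  · exact hT (-1) 2
  · refine (hT 1 2).trans ?_
    norm_num1
    linear_combination (norm := module) (-1 : ℚ) • h32
  · exact hT (-2) 1
  · refine (hT 2 3).trans ?_
    norm_num1
    linear_combination (norm := module) (-5 : ℚ) • h31 + (-5 : ℚ) • h32 + (1 : ℚ) • h53
  · exact hT (-3) 2
  · refine (hT 5 2).trans ?_
    norm_num1
    linear_combination (norm := module) (10 : ℚ) • h32 + (1 : ℚ) • h72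
  · refine (hT (-2) 5).trans ?_
    norm_num1
    linear_combination (norm := module) (5 : ℚ) • h13 + (5 : ℚ) • h23 + (-1 : ℚ) • h25 + (-1 : ℚ) •
        h25b
  · exact hS 1 0
  · refine (hS 0 1).trans ((hn 1 0).trans ?_)
    module
  · exact hS 1 1
  · refine (hS (-1) 1).trans ((hn 1 1).trans ?_)
    module
  · exact hS 2 1
  · refine (hS (-1) 2).trans ((hn 2 1).trans ?_)
    module
  · exact hS 1 2
  · refine (hS (-2) 1).trans ((hn 1 2).trans ?_)
    module
  · exact hS 2 3
  · refine (hS (-3) 2).trans ((hn 2 3).trans ?_)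
    module
  · exact hS 5 2
  · refine (hS (-2) 5).trans ((hn 5 2).trans ?_)
    module

/-- Twelve vectors spanning the submodule generated by a vector fixed by `T` and negated by `S²`. -/
theorem exists_odd_basis {x : V} (hx : act V T x = x) (hε : act V S (act V S x) = (-1 : ℚ) • x)
    (h5 : ∀ y : V, ((act V T - 1 : Module.End ℚ V) ^ 5) y = 0) :
    ∃ e0 e1 e2 e3 e4 e5 e6 e7 e8 e9 e10 e11 : V, e0 = x ∧
      act V T e0 = e0 ∧
      act V T e1 = e2 ∧
      act V T e2 = e4 ∧
      act V T e3 = e1 ∧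
      act V T e4 = (10 : ℚ) • e1 - (10 : ℚ) • e2 - (5 : ℚ) • e3 + (5 : ℚ) • e4 + e7 ∧
      act V T e5 = e6 ∧
      act V T e6 = -(10 : ℚ) • e0 - (10 : ℚ) • e1 + (5 : ℚ) • e4 + (5 : ℚ) • e6 - e8 ∧
      act V T e7 = e3 ∧
      act V T e8 = -(60 : ℚ) • e0 - (60 : ℚ) • e2 - (25 : ℚ) • e3 + (50 : ℚ) • e4 + (25 : ℚ) • e6 +
          (5 : ℚ) • e7 - (5 : ℚ) • e8 - e10 ∧
      act V T e9 = e5 ∧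
      act V T e10 = (100 : ℚ) • e0 + (100 : ℚ) • e1 - (50 : ℚ) • e4 - (5 : ℚ) • e5 - (40 : ℚ) • e6
          + (10 : ℚ) • e8 + e9 + (5 : ℚ) • e10 ∧
      act V T e11 = (40 : ℚ) • e1 - (60 : ℚ) • e2 + (25 : ℚ) • e3 + (10 : ℚ) • e4 - (30 : ℚ) • e5 +
          (25 : ℚ) • e6 - (15 : ℚ) • e7 + (5 : ℚ) • e9 + e11 ∧
      act V S e0 = e1 ∧
      act V S e1 = -e0 ∧
      act V S e2 = e3 ∧
      act V S e3 = -e2 ∧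
      act V S e4 = e5 ∧
      act V S e5 = -e4 ∧
      act V S e6 = e7 ∧
      act V S e7 = -e6 ∧
      act V S e8 = e9 ∧
      act V S e9 = -e8 ∧
      act V S e10 = e11 ∧
      act V S e11 = -e10 := by
  obtain ⟨h31, h13, h32, h23, h53, h72, h25, h25b⟩ := cusp_relations hx hε h5
  have hT := act_T_cusp hx
  have hS := act_S_cusp hx
  have hn := cusp_neg hx hε
  refine ⟨cusp x 1 0, cusp x 0 1, cusp x 1 1, cusp x (-1) 1, cusp x 2 1, cusp x (-1) 2, cusp x 1 2,
      cusp x (-2) 1, cusp x 2 3, cusp x (-3) 2, cusp x 5 2, cusp x (-2) 5, cusp_one_zero hx,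
    ?_, ?_, ?_, ?_, ?_, ?_, ?_, ?_, ?_, ?_, ?_, ?_, ?_, ?_, ?_, ?_, ?_, ?_, ?_, ?_, ?_, ?_, ?_, ?_⟩
  · exact hT 1 0
  · exact hT 0 1
  · exact hT 1 1
  · exact hT (-1) 1
  · refine (hT 2 1).trans ?_
    norm_num1
    linear_combination (norm := module) (1 : ℚ) • h31
  · exact hT (-1) 2
  · refine (hT 1 2).trans ?_
    norm_num1
    linear_combination (norm := module) (1 : ℚ) • h32
  · exact hT (-2) 1
  · refine (hT 2 3).trans ?_
    norm_num1
    linear_combination (norm := module) (5 : ℚ) • h31 + (5 : ℚ) • h32 + (1 : ℚ) • h53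
  · exact hT (-3) 2
  · refine (hT 5 2).trans ?_
    norm_num1
    linear_combination (norm := module) (-10 : ℚ) • h32 + (1 : ℚ) • h72
  · refine (hT (-2) 5).trans ?_
    norm_num1
    linear_combination (norm := module) (-5 : ℚ) • h13 + (-5 : ℚ) • h23 + (1 : ℚ) • h25 + (-1 : ℚ)
        • h25b
  · exact hS 1 0
  · refine (hS 0 1).trans ((hn 1 0).trans ?_)
    module
  · exact hS 1 1
  · refine (hS (-1) 1).trans ((hn 1 1).trans ?_)
    module
  · exact hS 2 1
  · refine (hS (-1) 2).trans ((hn 2 1).trans ?_)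
    module
  · exact hS 1 2
  · refine (hS (-2) 1).trans ((hn 1 2).trans ?_)
    module
  · exact hS 2 3
  · refine (hS (-3) 2).trans ((hn 2 3).trans ?_)
    module
  · exact hS 5 2
  · refine (hS (-2) 5).trans ((hn 5 2).trans ?_)
    module

end

/-! ### Explicit filtrations of the twelve-vector modules -/

theorem sub_mem_of_eq {R M : Type*} [Ring R] [AddCommGroup M] [Module R M] {W : Submodule R M}
    {a b : M} (h : a = b) : a - b ∈ W :=
  sub_eq_zero.2 h ▸ W.zero_mem

theorem add_mem_of_eq_neg {R M : Type*} [Ring R] [AddCommGroup M] [Module R M] {W : Submodule R M}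
    {a b : M} (h : a = -b) : a + b ∈ W :=
  eq_neg_iff_add_eq_zero.1 h ▸ W.zero_mem

section

variable {V : Type*} [AddCommGroup V] [Module ℚ V] [Module (MonoidAlgebra ℚ SL(2, ℤ)) V]
  [IsScalarTower ℚ (MonoidAlgebra ℚ SL(2, ℤ)) V]

theorem isSymMod_zero {W : Submodule (MonoidAlgebra ℚ SL(2, ℤ)) V} {m0 : V}
    (hT0 : act V T m0 - (m0) ∈ W)
    (hS0 : act V S m0 - m0 ∈ W) :
    IsSymMod W 0 ![m0] := by
  intro i
  fin_cases i
  · exact ⟨by simpa [Fin.sum_univ_one, Nat.choose] using hT0, by simpa [Fin.rev, pow_succ] using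
        hS0⟩

theorem isSymMod_one {W : Submodule (MonoidAlgebra ℚ SL(2, ℤ)) V} {m0 m1 : V}
    (hT0 : act V T m0 - (m0) ∈ W)
    (hT1 : act V T m1 - (m0 + m1) ∈ W)
    (hS0 : act V S m0 - m1 ∈ W)
    (hS1 : act V S m1 + m0 ∈ W) :
    IsSymMod W 1 ![m0, m1] := by
  intro i
  fin_cases i
  · exact ⟨by simpa [Fin.sum_univ_two, Nat.choose] using hT0, by simpa [Fin.rev, pow_succ] using
        hS0⟩
  · exact ⟨by simpa [Fin.sum_univ_two, Nat.choose] using hT1, by simpa [Fin.rev, pow_succ] using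
        hS1⟩

theorem isSymMod_two {W : Submodule (MonoidAlgebra ℚ SL(2, ℤ)) V} {m0 m1 m2 : V}
    (hT0 : act V T m0 - (m0) ∈ W)
    (hT1 : act V T m1 - (m0 + m1) ∈ W)
    (hT2 : act V T m2 - (m0 + (2 : ℚ) • m1 + m2) ∈ W)
    (hS0 : act V S m0 - m2 ∈ W)
    (hS1 : act V S m1 + m1 ∈ W)
    (hS2 : act V S m2 - m0 ∈ W) :
    IsSymMod W 2 ![m0, m1, m2] := by
  intro i
  fin_cases i
  · exact ⟨by simpa [Fin.sum_univ_three, Nat.choose] using hT0, by simpa [Fin.rev, pow_succ] using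
        hS0⟩
  · exact ⟨by simpa [Fin.sum_univ_three, Nat.choose] using hT1, by simpa [Fin.rev, pow_succ] using
        hS1⟩
  · exact ⟨by simpa [Fin.sum_univ_three, Nat.choose] using hT2, by simpa [Fin.rev, pow_succ] using
        hS2⟩

theorem isSymMod_three {W : Submodule (MonoidAlgebra ℚ SL(2, ℤ)) V} {m0 m1 m2 m3 : V}
    (hT0 : act V T m0 - (m0) ∈ W)
    (hT1 : act V T m1 - (m0 + m1) ∈ W)
    (hT2 : act V T m2 - (m0 + (2 : ℚ) • m1 + m2) ∈ W)
    (hT3 : act V T m3 - (m0 + (3 : ℚ) • m1 + (3 : ℚ) • m2 + m3) ∈ W)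
    (hS0 : act V S m0 - m3 ∈ W)
    (hS1 : act V S m1 + m2 ∈ W)
    (hS2 : act V S m2 - m1 ∈ W)
    (hS3 : act V S m3 + m0 ∈ W) :
    IsSymMod W 3 ![m0, m1, m2, m3] := by
  intro i
  fin_cases i
  · exact ⟨by simpa [Fin.sum_univ_four, Nat.choose] using hT0, by simpa [Fin.rev, pow_succ] using
        hS0⟩
  · exact ⟨by simpa [Fin.sum_univ_four, Nat.choose] using hT1, by simpa [Fin.rev, pow_succ] using
        hS1⟩
  · exact ⟨by simpa [Fin.sum_univ_four, Nat.choose] using hT2, by simpa [Fin.rev, pow_succ] using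
        hS2⟩
  · exact ⟨by simpa [Fin.sum_univ_four, Nat.choose] using hT3, by simpa [Fin.rev, pow_succ] using
        hS3⟩

theorem isSymMod_four {W : Submodule (MonoidAlgebra ℚ SL(2, ℤ)) V} {m0 m1 m2 m3 m4 : V}
    (hT0 : act V T m0 - (m0) ∈ W)
    (hT1 : act V T m1 - (m0 + m1) ∈ W)
    (hT2 : act V T m2 - (m0 + (2 : ℚ) • m1 + m2) ∈ W)
    (hT3 : act V T m3 - (m0 + (3 : ℚ) • m1 + (3 : ℚ) • m2 + m3) ∈ W)
    (hT4 : act V T m4 - (m0 + (4 : ℚ) • m1 + (6 : ℚ) • m2 + (4 : ℚ) • m3 + m4) ∈ W)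
    (hS0 : act V S m0 - m4 ∈ W)
    (hS1 : act V S m1 + m3 ∈ W)
    (hS2 : act V S m2 - m2 ∈ W)
    (hS3 : act V S m3 + m1 ∈ W)
    (hS4 : act V S m4 - m0 ∈ W) :
    IsSymMod W 4 ![m0, m1, m2, m3, m4] := by
  intro i
  fin_cases i
  · exact ⟨by simpa [Fin.sum_univ_five, Nat.choose] using hT0, by simpa [Fin.rev, pow_succ] using
        hS0⟩
  · exact ⟨by simpa [Fin.sum_univ_five, Nat.choose] using hT1, by simpa [Fin.rev, pow_succ] using
        hS1⟩
  · exact ⟨by simpa [Fin.sum_univ_five, Nat.choose] using hT2, by simpa [Fin.rev, pow_succ] using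
        hS2⟩
  · exact ⟨by simpa [Fin.sum_univ_five, Nat.choose] using hT3, by simpa [Fin.rev, pow_succ] using
        hS3⟩
  · exact ⟨by simpa [Fin.sum_univ_five, Nat.choose] using hT4, by simpa [Fin.rev, pow_succ] using
        hS4⟩

/-- A vector fixed by `T` and `S²` lies in an iterated extension by symmetric powers of even
degree. -/
theorem mem_symStep_of_even {x : V} (hx : act V T x = x)
    (hε : act V S (act V S x) = (1 : ℚ) • x)
    (h5 : ∀ y : V, ((act V T - 1 : Module.End ℚ V) ^ 5) y = 0) :
    x ∈ symStep 2 (symStep 4 (symStep 2 (symStep 0 ⊥))) := by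
  obtain ⟨e0, e1, e2, e3, e4, e5, e6, e7, e8, e9, e10, e11, rfl, T0, T1, T2, T3, T4, T5, T6, T7,
      T8, T9, T10, T11,
    S0, S1, S2, S3, S4, S5, S6, S7, S8, S9, S10, S11⟩ :=
    exists_even_basis hx hε h5
  clear hx hε h5
  -- The coefficients give an invariant vector. The existential form keeps it opaque, to be unfolded
  -- only through `ha0`.
  obtain ⟨a0, ha0⟩ : ∃ v : V, v = -(134 : ℚ) • e0 - (134 : ℚ) • e1 + (136 : ℚ) • e2 + (136 : ℚ)
    • e3 - (39 : ℚ) • e4 - (39 : ℚ) • e5 + (16 : ℚ) • e6 + (16 : ℚ) • e7 - (4 : ℚ) • e8 - (4 :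
    ℚ) • e9 + e10 + e11 := ⟨_, rfl⟩
  have Ta0 : act V T a0 = a0 := by
    simp only [ha0, map_add, map_sub, map_smul, T0, T1, T2, T3, T4, T5, T6, T7, T8, T9, T10,
      T11]
    module
  have Sa0 : act V S a0 = a0 := by
    simp only [ha0, map_add, map_sub, map_smul, S0, S1, S2, S3, S4, S5, S6, S7, S8, S9, S10,
      S11]
    module
  have sym_a : IsSymMod (⊥) 0 ![a0] :=
    isSymMod_zero (sub_mem_of_eq Ta0) (sub_mem_of_eq Sa0)
  have mem_a0 := sym_a.mem_symStep 0
  -- These vectors obey the `Sym²` formulas exactly, as `c0`, …, `c4` below do those of `Sym⁴`; only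
  -- the last layer needs corrections from lower ones.
  obtain ⟨b0, hb0⟩ : ∃ v : V, v = (40 : ℚ) • e0 - (136 : ℚ) • e1 + (64 : ℚ) • e2 + (64 : ℚ) • e3
    - (36 : ℚ) • e4 - (4 : ℚ) • e5 + (26 : ℚ) • e6 - (16 : ℚ) • e7 - (4 : ℚ) • e8 + e9 + e10 :=
    ⟨_, rfl⟩
  obtain ⟨b1, hb1⟩ : ∃ v : V, v = -(10 : ℚ) • e0 + (10 : ℚ) • e1 + (16 : ℚ) • e2 - (16 : ℚ) • e3
    - (3 : ℚ) • e4 + (3 : ℚ) • e5 - (8 : ℚ) • e6 + (8 : ℚ) • e7 + e8 - e9 := ⟨_, rfl⟩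
  obtain ⟨b2, hb2⟩ : ∃ v : V, v = -(136 : ℚ) • e0 + (40 : ℚ) • e1 + (64 : ℚ) • e2 + (64 : ℚ) •
    e3 - (4 : ℚ) • e4 - (36 : ℚ) • e5 - (16 : ℚ) • e6 + (26 : ℚ) • e7 + e8 - (4 : ℚ) • e9 + e11
    := ⟨_, rfl⟩
  have Tb0 : act V T b0 = b0 := by
    simp only [hb0, map_add, map_sub, map_smul, T0, T1, T2, T3, T4, T5, T6, T7, T8, T9, T10]
    module
  have Tb1 : act V T b1 = b0 + b1 := by
    simp only [hb0, hb1, map_add, map_sub, map_smul, T0, T1, T2, T3, T4, T5, T6, T7, T8, T9]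
    module
  have Tb2 : act V T b2 = b0 + (2 : ℚ) • b1 + b2 := by
    simp only [hb0, hb1, hb2, map_add, map_sub, map_smul, T0, T1, T2, T3, T4, T5, T6, T7, T8,
      T9, T11]
    module
  have Sb0 : act V S b0 = b2 := by
    simp only [hb0, hb2, map_add, map_sub, map_smul, S0, S1, S2, S3, S4, S5, S6, S7, S8, S9,
      S10]
    module
  have Sb1 : act V S b1 = -b1 := by
    simp only [hb1, map_add, map_sub, map_smul, S0, S1, S2, S3, S4, S5, S6, S7, S8, S9]
    module
  have Sb2 : act V S b2 = b0 := by
    simp only [hb0, hb2, map_add, map_sub, map_smul, S0, S1, S2, S3, S4, S5, S6, S7, S8, S9,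
      S11]
    module
  have sym_b : IsSymMod (symStep 0 ⊥) 2 ![b0, b1, b2] :=
    isSymMod_two (sub_mem_of_eq Tb0) (sub_mem_of_eq Tb1) (sub_mem_of_eq Tb2) (sub_mem_of_eq Sb0)
      (add_mem_of_eq_neg Sb1) (sub_mem_of_eq Sb2)
  replace mem_a0 := le_symStep 2 _ mem_a0
  have mem_b0 := sym_b.mem_symStep 0
  have mem_b1 := sym_b.mem_symStep 1
  have mem_b2 := sym_b.mem_symStep 2
  obtain ⟨c0, hc0⟩ : ∃ v : V, v = (40 : ℚ) • e0 - (64 : ℚ) • e1 + (16 : ℚ) • e2 + (16 : ℚ) • e3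
    - (24 : ℚ) • e4 - (4 : ℚ) • e5 + (26 : ℚ) • e6 - (4 : ℚ) • e7 - (4 : ℚ) • e8 + e9 + e10 :=
    ⟨_, rfl⟩
  obtain ⟨c1, hc1⟩ : ∃ v : V, v = -(10 : ℚ) • e0 + (10 : ℚ) • e1 + (4 : ℚ) • e2 - (4 : ℚ) • e3 +
    (3 : ℚ) • e4 + (3 : ℚ) • e5 - (8 : ℚ) • e6 + (2 : ℚ) • e7 + e8 - e9 := ⟨_, rfl⟩
  obtain ⟨c2, hc2⟩ : ∃ v : V, v = -(10 : ℚ) • e0 - (10 : ℚ) • e1 + (16 : ℚ) • e2 + (16 : ℚ) • e3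
    - e4 - e5 - (6 : ℚ) • e6 - (6 : ℚ) • e7 + e8 + e9 := ⟨_, rfl⟩
  obtain ⟨c3, hc3⟩ : ∃ v : V, v = -(10 : ℚ) • e0 + (10 : ℚ) • e1 + (4 : ℚ) • e2 - (4 : ℚ) • e3 -
    (3 : ℚ) • e4 - (3 : ℚ) • e5 - (2 : ℚ) • e6 + (8 : ℚ) • e7 + e8 - e9 := ⟨_, rfl⟩
  obtain ⟨c4, hc4⟩ : ∃ v : V, v = -(64 : ℚ) • e0 + (40 : ℚ) • e1 + (16 : ℚ) • e2 + (16 : ℚ) • e3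
    - (4 : ℚ) • e4 - (24 : ℚ) • e5 - (4 : ℚ) • e6 + (26 : ℚ) • e7 + e8 - (4 : ℚ) • e9 + e11 :=
    ⟨_, rfl⟩
  have Tc0 : act V T c0 = c0 := by
    simp only [hc0, map_add, map_sub, map_smul, T0, T1, T2, T3, T4, T5, T6, T7, T8, T9, T10]
    module
  have Tc1 : act V T c1 = c0 + c1 := by
    simp only [hc0, hc1, map_add, map_sub, map_smul, T0, T1, T2, T3, T4, T5, T6, T7, T8, T9]
    module
  have Tc2 : act V T c2 = c0 + (2 : ℚ) • c1 + c2 := by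
    simp only [hc0, hc1, hc2, map_add, map_sub, map_smul, T0, T1, T2, T3, T4, T5, T6, T7, T8,
      T9]
    module
  have Tc3 : act V T c3 = c0 + (3 : ℚ) • c1 + (3 : ℚ) • c2 + c3 := by
    simp only [hc0, hc1, hc2, hc3, map_add, map_sub, map_smul, T0, T1, T2, T3, T4, T5, T6, T7,
      T8, T9]
    module
  have Tc4 : act V T c4 = c0 + (4 : ℚ) • c1 + (6 : ℚ) • c2 + (4 : ℚ) • c3 + c4 := by
    simp only [hc0, hc1, hc2, hc3, hc4, map_add, map_sub, map_smul, T0, T1, T2, T3, T4, T5, T6,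
      T7, T8, T9, T11]
    module
  have Sc0 : act V S c0 = c4 := by
    simp only [hc0, hc4, map_add, map_sub, map_smul, S0, S1, S2, S3, S4, S5, S6, S7, S8, S9,
      S10]
    module
  have Sc1 : act V S c1 = -c3 := by
    simp only [hc1, hc3, map_add, map_sub, map_smul, S0, S1, S2, S3, S4, S5, S6, S7, S8, S9]
    module
  have Sc2 : act V S c2 = c2 := by
    simp only [hc2, map_add, map_sub, map_smul, S0, S1, S2, S3, S4, S5, S6, S7, S8, S9]
    module
  have Sc3 : act V S c3 = -c1 := by
    simp only [hc1, hc3, map_add, map_sub, map_smul, S0, S1, S2, S3, S4, S5, S6, S7, S8, S9]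
    module
  have Sc4 : act V S c4 = c0 := by
    simp only [hc0, hc4, map_add, map_sub, map_smul, S0, S1, S2, S3, S4, S5, S6, S7, S8, S9,
      S11]
    module
  have sym_c : IsSymMod (symStep 2 (symStep 0 ⊥)) 4 ![c0, c1, c2, c3, c4] :=
    isSymMod_four (sub_mem_of_eq Tc0) (sub_mem_of_eq Tc1) (sub_mem_of_eq Tc2) (sub_mem_of_eq
      Tc3) (sub_mem_of_eq Tc4) (sub_mem_of_eq Sc0) (add_mem_of_eq_neg Sc1) (sub_mem_of_eq Sc2)
      (add_mem_of_eq_neg Sc3) (sub_mem_of_eq Sc4)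
  replace mem_a0 := le_symStep 4 _ mem_a0
  replace mem_b0 := le_symStep 4 _ mem_b0
  replace mem_b1 := le_symStep 4 _ mem_b1
  replace mem_b2 := le_symStep 4 _ mem_b2
  have mem_c0 := sym_c.mem_symStep 0
  have mem_c1 := sym_c.mem_symStep 1
  have mem_c2 := sym_c.mem_symStep 2
  have mem_c3 := sym_c.mem_symStep 3
  have mem_c4 := sym_c.mem_symStep 4
  obtain ⟨d0, hd0⟩ : ∃ v : V, v = e0 := ⟨_, rfl⟩
  -- If `e0`, `e1`, `e2` are to be the squares of `(1,0)`, `(0,1)`, `(1,1)`, then polarization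
  -- forces this value for the mixed product.
  obtain ⟨d1, hd1⟩ : ∃ v : V, v = (1 / 2 : ℚ) • (e2 - e0 - e1) := ⟨_, rfl⟩
  obtain ⟨d2, hd2⟩ : ∃ v : V, v = e1 := ⟨_, rfl⟩
  have Td0 : act V T d0 = d0 := by
    simp only [hd0, T0]
  have Td1 : act V T d1 - (d0 + d1) = (1 / 48 : ℚ) • a0 - (1 / 24 : ℚ) • b0 - (1 / 24 : ℚ) • b1
      - (1 / 48 : ℚ) • b2 + (1 / 48 : ℚ) • c0 + (1 / 24 : ℚ) • c1 + (1 / 48 : ℚ) • c2 := by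
    simp only [hd0, hd1, ha0, hb0, hb1, hb2, hc0, hc1, hc2, map_sub, map_smul, T0, T1,
      T2]
    module
  have Td2 : act V T d2 = d0 + (2 : ℚ) • d1 + d2 := by
    simp only [hd0, hd1, hd2, T1]
    module
  have Sd0 : act V S d0 = d2 := by
    simp only [hd0, hd2, S0]
  have Sd1 : act V S d1 + d1 = (1 / 48 : ℚ) • a0 - (1 / 48 : ℚ) • b0 - (1 / 48 : ℚ) • b2 + (1 /
      48 : ℚ) • c2 := by
    simp only [hd1, ha0, hb0, hb2, hc2, map_sub, map_smul, S0, S1, S2]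
    module
  have Sd2 : act V S d2 = d0 := by
    simp only [hd0, hd2, S1]
  have sym_d : IsSymMod (symStep 4 (symStep 2 (symStep 0 ⊥))) 2 ![d0, d1, d2] :=
    isSymMod_two (sub_mem_of_eq Td0) (Td1 ▸ add_mem (add_mem (add_mem (sub_mem (sub_mem (sub_mem
      (ratSMul_mem mem_a0 _) (ratSMul_mem mem_b0 _)) (ratSMul_mem mem_b1 _)) (ratSMul_mem mem_b2
      _)) (ratSMul_mem mem_c0 _)) (ratSMul_mem mem_c1 _)) (ratSMul_mem mem_c2 _)) (sub_mem_of_eq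
      Td2) (sub_mem_of_eq Sd0) (Sd1 ▸ add_mem (sub_mem (sub_mem (ratSMul_mem mem_a0 _)
      (ratSMul_mem mem_b0 _)) (ratSMul_mem mem_b2 _)) (ratSMul_mem mem_c2 _)) (sub_mem_of_eq
      Sd2)
  rw [← hd0]
  exact sym_d.mem_symStep 0

/-- A vector fixed by `T` and negated by `S²` lies in an iterated extension by symmetric powers of
odd degree. -/
theorem mem_symStep_of_odd {x : V} (hx : act V T x = x)
    (hε : act V S (act V S x) = (-1 : ℚ) • x)
    (h5 : ∀ y : V, ((act V T - 1 : Module.End ℚ V) ^ 5) y = 0) :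
    x ∈ symStep 1 (symStep 3 (symStep 3 (symStep 1 ⊥))) := by
  obtain ⟨e0, e1, e2, e3, e4, e5, e6, e7, e8, e9, e10, e11, rfl, T0, T1, T2, T3, T4, T5, T6, T7,
      T8, T9, T10, T11,
    S0, S1, S2, S3, S4, S5, S6, S7, S8, S9, S10, S11⟩ :=
    exists_odd_basis hx hε h5
  clear hx hε h5
  obtain ⟨a0, ha0⟩ : ∃ v : V, v = (40 : ℚ) • e0 + (28 : ℚ) • e1 + (8 : ℚ) • e2 + (8 : ℚ) • e3 -
    (22 : ℚ) • e4 - (4 : ℚ) • e5 - (14 : ℚ) • e6 - (2 : ℚ) • e7 + (4 : ℚ) • e8 + e9 + e10 := ⟨_,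
    rfl⟩
  obtain ⟨a1, ha1⟩ : ∃ v : V, v = -(28 : ℚ) • e0 + (40 : ℚ) • e1 - (8 : ℚ) • e2 + (8 : ℚ) • e3 +
    (4 : ℚ) • e4 - (22 : ℚ) • e5 + (2 : ℚ) • e6 - (14 : ℚ) • e7 - e8 + (4 : ℚ) • e9 + e11 := ⟨_,
    rfl⟩
  have Ta0 : act V T a0 = a0 := by
    simp only [ha0, map_add, map_sub, map_smul, T0, T1, T2, T3, T4, T5, T6, T7, T8, T9, T10]
    module
  have Ta1 : act V T a1 = a0 + a1 := by
    simp only [ha0, ha1, map_add, map_sub, map_smul, T0, T1, T2, T3, T4, T5, T6, T7, T8, T9,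
      T11]
    module
  have Sa0 : act V S a0 = a1 := by
    simp only [ha0, ha1, map_add, map_sub, map_smul, S0, S1, S2, S3, S4, S5, S6, S7,
      S8, S9, S10]
    module
  have Sa1 : act V S a1 = -a0 := by
    simp only [ha0, ha1, map_add, map_sub, map_smul, S0, S1, S2, S3, S4, S5, S6, S7,
      S8, S9, S11]
    module
  have sym_a : IsSymMod (⊥) 1 ![a0, a1] :=
    isSymMod_one (sub_mem_of_eq Ta0) (sub_mem_of_eq Ta1) (sub_mem_of_eq Sa0) (add_mem_of_eq_neg
      Sa1)
  have mem_a0 := sym_a.mem_symStep 0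
  have mem_a1 := sym_a.mem_symStep 1
  obtain ⟨b0, hb0⟩ : ∃ v : V, v = (40 : ℚ) • e0 - (8 : ℚ) • e1 + (32 : ℚ) • e2 + (32 : ℚ) • e3 -
    (28 : ℚ) • e4 - (4 : ℚ) • e5 - (14 : ℚ) • e6 - (8 : ℚ) • e7 + (4 : ℚ) • e8 + e9 + e10 := ⟨_,
    rfl⟩
  obtain ⟨b1, hb1⟩ : ∃ v : V, v = -(10 : ℚ) • e0 - (10 : ℚ) • e1 + (8 : ℚ) • e2 - (8 : ℚ) • e3 +
    e4 + (3 : ℚ) • e5 + (2 : ℚ) • e6 + (4 : ℚ) • e7 - e8 - e9 := ⟨_, rfl⟩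
  obtain ⟨b2, hb2⟩ : ∃ v : V, v = -(10 : ℚ) • e0 + (10 : ℚ) • e1 - (8 : ℚ) • e2 - (8 : ℚ) • e3 +
    (3 : ℚ) • e4 - e5 + (4 : ℚ) • e6 - (2 : ℚ) • e7 - e8 + e9 := ⟨_, rfl⟩
  obtain ⟨b3, hb3⟩ : ∃ v : V, v = (8 : ℚ) • e0 + (40 : ℚ) • e1 - (32 : ℚ) • e2 + (32 : ℚ) • e3 +
    (4 : ℚ) • e4 - (28 : ℚ) • e5 + (8 : ℚ) • e6 - (14 : ℚ) • e7 - e8 + (4 : ℚ) • e9 + e11 := ⟨_,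
    rfl⟩
  have Tb0 : act V T b0 = b0 := by
    simp only [hb0, map_add, map_sub, map_smul, T0, T1, T2, T3, T4, T5, T6, T7, T8, T9, T10]
    module
  have Tb1 : act V T b1 = b0 + b1 := by
    simp only [hb0, hb1, map_add, map_sub, map_smul, T0, T1, T2, T3, T4, T5, T6, T7, T8, T9]
    module
  have Tb2 : act V T b2 = b0 + (2 : ℚ) • b1 + b2 := by
    simp only [hb0, hb1, hb2, map_add, map_sub, map_smul, T0, T1, T2, T3, T4, T5, T6, T7, T8,
      T9]
    module
  have Tb3 : act V T b3 = b0 + (3 : ℚ) • b1 + (3 : ℚ) • b2 + b3 := by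
    simp only [hb0, hb1, hb2, hb3, map_add, map_sub, map_smul, T0, T1, T2, T3, T4, T5, T6, T7,
      T8, T9, T11]
    module
  have Sb0 : act V S b0 = b3 := by
    simp only [hb0, hb3, map_add, map_sub, map_smul, S0, S1, S2, S3, S4, S5, S6, S7,
      S8, S9, S10]
    module
  have Sb1 : act V S b1 = -b2 := by
    simp only [hb1, hb2, map_add, map_sub, map_smul, S0, S1, S2, S3, S4, S5, S6, S7,
      S8, S9]
    module
  have Sb2 : act V S b2 = b1 := by
    simp only [hb1, hb2, map_add, map_sub, map_smul, S0, S1, S2, S3, S4, S5, S6, S7,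
      S8, S9]
    module
  have Sb3 : act V S b3 = -b0 := by
    simp only [hb0, hb3, map_add, map_sub, map_smul, S0, S1, S2, S3, S4, S5, S6, S7,
      S8, S9, S11]
    module
  have sym_b : IsSymMod (symStep 1 ⊥) 3 ![b0, b1, b2, b3] :=
    isSymMod_three (sub_mem_of_eq Tb0) (sub_mem_of_eq Tb1) (sub_mem_of_eq Tb2) (sub_mem_of_eq
      Tb3) (sub_mem_of_eq Sb0) (add_mem_of_eq_neg Sb1) (sub_mem_of_eq Sb2) (add_mem_of_eq_neg
      Sb3)
  replace mem_a0 := le_symStep 3 _ mem_a0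
  replace mem_a1 := le_symStep 3 _ mem_a1
  have mem_b0 := sym_b.mem_symStep 0
  have mem_b1 := sym_b.mem_symStep 1
  have mem_b2 := sym_b.mem_symStep 2
  have mem_b3 := sym_b.mem_symStep 3
  -- Unlike the two layers before it, this copy of `Sym³` exists only modulo them: `T` on `c0` and
  -- `c3` has error terms in the `a`'s and `b`'s.
  obtain ⟨c0, hc0⟩ : ∃ v : V, v = (3 : ℚ) • e1 - (3 : ℚ) • e2 - e3 + e4 := ⟨_, rfl⟩
  obtain ⟨c1, hc1⟩ : ∃ v : V, v = -(2 : ℚ) • e1 + e2 + e3 := ⟨_, rfl⟩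
  obtain ⟨c2, hc2⟩ : ∃ v : V, v = -(2 : ℚ) • e0 + e2 - e3 := ⟨_, rfl⟩
  obtain ⟨c3, hc3⟩ : ∃ v : V, v = -(3 : ℚ) • e0 + e2 - (3 : ℚ) • e3 + e5 := ⟨_, rfl⟩
  have Tc0 : act V T c0 - (c0) = (1 / 6 : ℚ) • a0 - (1 / 6 : ℚ) • b0 := by
    simp only [hc0, ha0, hb0, map_add, map_sub, map_smul, T1, T2, T3, T4]
    module
  have Tc1 : act V T c1 = c0 + c1 := by
    simp only [hc0, hc1, map_add, map_smul, T1, T2, T3]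
    module
  have Tc2 : act V T c2 = c0 + (2 : ℚ) • c1 + c2 := by
    simp only [hc0, hc1, hc2, map_add, map_sub, map_smul, T0, T2, T3]
    module
  have Tc3 : act V T c3 - (c0 + (3 : ℚ) • c1 + (3 : ℚ) • c2 + c3) = (-1 / 6 : ℚ) • a1 + (1 / 6 :
      ℚ) • b3 := by
    simp only [hc0, hc1, hc2, hc3, ha1, hb3, map_add, map_sub, map_smul, T0, T2, T3, T5]
    module
  have Sc0 : act V S c0 = c3 := by
    simp only [hc0, hc3, map_add, map_sub, map_smul, S1, S2, S3, S4]
    module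
  have Sc1 : act V S c1 = -c2 := by
    simp only [hc1, hc2, map_add, map_smul, S1, S2, S3]
    module
  have Sc2 : act V S c2 = c1 := by
    simp only [hc1, hc2, map_add, map_sub, map_smul, S0, S2, S3]
    module
  have Sc3 : act V S c3 = -c0 := by
    simp only [hc0, hc3, map_add, map_sub, map_smul, S0, S2, S3, S5]
    module
  have sym_c : IsSymMod (symStep 3 (symStep 1 ⊥)) 3 ![c0, c1, c2, c3] :=
    isSymMod_three (Tc0 ▸ sub_mem (ratSMul_mem mem_a0 _) (ratSMul_mem mem_b0 _)) (sub_mem_of_eq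
      Tc1) (sub_mem_of_eq Tc2) (Tc3 ▸ add_mem (ratSMul_mem mem_a1 _) (ratSMul_mem mem_b3 _))
      (sub_mem_of_eq Sc0) (add_mem_of_eq_neg Sc1) (sub_mem_of_eq Sc2) (add_mem_of_eq_neg Sc3)
  replace mem_a0 := le_symStep 3 _ mem_a0
  replace mem_a1 := le_symStep 3 _ mem_a1
  replace mem_b0 := le_symStep 3 _ mem_b0
  replace mem_b1 := le_symStep 3 _ mem_b1
  replace mem_b2 := le_symStep 3 _ mem_b2
  replace mem_b3 := le_symStep 3 _ mem_b3
  have mem_c0 := sym_c.mem_symStep 0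
  have mem_c1 := sym_c.mem_symStep 1
  have mem_c2 := sym_c.mem_symStep 2
  have mem_c3 := sym_c.mem_symStep 3
  -- The pair `x`, `S x` forms the top layer `Sym¹`; its only defect is `(c1 + c2) / 2`.
  obtain ⟨d0, hd0⟩ : ∃ v : V, v = e0 := ⟨_, rfl⟩
  obtain ⟨d1, hd1⟩ : ∃ v : V, v = e1 := ⟨_, rfl⟩
  have Td0 : act V T d0 = d0 := by
    simp only [hd0, T0]
  have Td1 : act V T d1 - (d0 + d1) = (1 / 2 : ℚ) • c1 + (1 / 2 : ℚ) • c2 := by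
    simp only [hd0, hd1, hc1, hc2, T1]
    module
  have Sd0 : act V S d0 = d1 := by
    simp only [hd0, hd1, S0]
  have Sd1 : act V S d1 = -d0 := by
    simp only [hd0, hd1, S1]
  have sym_d : IsSymMod (symStep 3 (symStep 3 (symStep 1 ⊥))) 1 ![d0, d1] :=
    isSymMod_one (sub_mem_of_eq Td0) (Td1 ▸ add_mem (ratSMul_mem mem_c1 _) (ratSMul_mem mem_c2
      _)) (sub_mem_of_eq Sd0) (add_mem_of_eq_neg Sd1)
  rw [← hd0]
  exact sym_d.mem_symStep 0

/-! ### The eight-step tower and induction on the power of `T - 1` -/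

theorem symStep_mono (k : ℕ) {W W' : Submodule (MonoidAlgebra ℚ SL(2, ℤ)) V} (h : W ≤ W') :
    symStep k W ≤ symStep k W' := by
  refine sup_le (h.trans (le_symStep k W')) (Submodule.span_le.2 ?_)
  rintro _ ⟨m, hm, i, rfl⟩
  exact (hm.mono h).mem_symStep i

/-- Eight successive extensions which capture all vectors fixed by `T` modulo `W`. -/
def symTower (W : Submodule (MonoidAlgebra ℚ SL(2, ℤ)) V) :
    Submodule (MonoidAlgebra ℚ SL(2, ℤ)) V :=
  symStep 1 (symStep 3 (symStep 3 (symStep 1 (symStep 2 (symStep 4 (symStep 2 (symStep 0 W)))))))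

/-- `S²` is central with square one, so `x` is half the sum of `x + S² x` and `x - S² x`, both still
fixed by `T`. -/
theorem mem_symTower_bot {x : V} (hx : act V T x = x)
    (h5 : ∀ y : V, ((act V T - 1 : Module.End ℚ V) ^ 5) y = 0) : x ∈ symTower (⊥ : Submodule _ V)
        := by
  have hcomm : ∀ g : SL(2, ℤ), g * (S * S) = S * S * g := by
    intro g
    ext i j
    fin_cases i <;> fin_cases j <;> simp [coe_S, Matrix.mul_apply, Fin.sum_univ_two]
  have hS4 : S * S * (S * S) = 1 := by
    ext i j
    fin_cases i <;> fin_cases j <;> simp [coe_S, Matrix.mul_apply, Fin.sum_univ_two]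
  have hfix : act V T (act V (S * S) x) = act V (S * S) x := by
    rw [← act_mul_apply, hcomm, act_mul_apply, hx]
  have hinv : act V (S * S) (act V (S * S) x) = x := by
    rw [← act_mul_apply, hS4, map_one, Module.End.one_apply]
  have heven : x + act V (S * S) x ∈ symTower (⊥ : Submodule _ V) := by
    have h := mem_symStep_of_even (x := x + act V (S * S) x) (by rw [map_add, hx, hfix])
      (by rw [← act_mul_apply, map_add, hinv, one_smul, add_comm]) h5
    exact le_symStep _ _ (le_symStep _ _ (le_symStep _ _ (le_symStep _ _ h)))
  have hodd : x - act V (S * S) x ∈ symTower (⊥ : Submodule _ V) := by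
    have h := mem_symStep_of_odd (x := x - act V (S * S) x) (by rw [map_sub, hx, hfix])
      (by rw [← act_mul_apply, map_sub, hinv, neg_one_smul, neg_sub]) h5
    -- The odd filtration starts at `0`; monotonicity places it on top of the even one.
    exact symStep_mono _ (symStep_mono _ (symStep_mono _ (symStep_mono _ bot_le))) h
  have h := ratSMul_mem (add_mem heven hodd) (1 / 2)
  convert h using 1
  module

/-- The image of `x` in `V ⧸ W` is honestly fixed by `T`, and the fifth-power identity descends; the
tower over `0` there pulls back into the tower over `W`. -/
theorem mem_symTower {W : Submodule (MonoidAlgebra ℚ SL(2, ℤ)) V} {x : V}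
    (hx : act V T x - x ∈ W) (h5 : ∀ y : V, ((act V T - 1 : Module.End ℚ V) ^ 5) y = 0) :
    x ∈ symTower W := by
  have hfix : act (V ⧸ W) T (W.mkQ x) = W.mkQ x := by
    rw [← map_act, ← sub_eq_zero, ← map_sub]
    exact (Submodule.Quotient.mk_eq_zero W).2 hx
  have hpow : ∀ (n : ℕ) (y : V), ((act (V ⧸ W) T - 1 : Module.End ℚ (V ⧸ W)) ^ n) (W.mkQ y) =
      W.mkQ (((act V T - 1 : Module.End ℚ V) ^ n) y) := by
    intro n
    induction n with
    | zero => intro y; rfl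
    | succ n ih =>
      intro y
      have h1 : (act (V ⧸ W) T - 1 : Module.End ℚ (V ⧸ W)) (W.mkQ y) =
          W.mkQ ((act V T - 1 : Module.End ℚ V) y) := by
        rw [LinearMap.sub_apply, LinearMap.sub_apply, Module.End.one_apply, Module.End.one_apply,
          map_sub, map_act]
      rw [pow_succ, pow_succ, Module.End.mul_apply, Module.End.mul_apply, h1, ih]
  have h5' : ∀ y : V ⧸ W, ((act (V ⧸ W) T - 1 : Module.End ℚ (V ⧸ W)) ^ 5) y = 0 := by
    intro y
    obtain ⟨y, rfl⟩ := W.mkQ_surjective y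
    rw [hpow, h5, map_zero]
  have hsurj := W.mkQ_surjective
  have hle : (symTower (⊥ : Submodule (MonoidAlgebra ℚ SL(2, ℤ)) (V ⧸ W))).comap W.mkQ ≤
      symTower W :=
    comap_symStep_le hsurj (comap_symStep_le hsurj (comap_symStep_le hsurj
      (comap_symStep_le hsurj (comap_symStep_le hsurj (comap_symStep_le hsurj
        (comap_symStep_le hsurj (comap_symStep_le hsurj (W.ker_mkQ.le))))))))
  exact hle (mem_symTower_bot hfix h5')

theorem reflTransGen_symTower (W : Submodule (MonoidAlgebra ℚ SL(2, ℤ)) V) :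
    Relation.ReflTransGen IsSymFactor W (symTower W) := by
  unfold symTower
  iterate 8 refine reflTransGen_symStep (by norm_num) ?_
  exact .refl

/-- Every vector `(T - 1)^n y` is fixed by `T` modulo `W`, so one tower lowers the exponent by one.
-/
theorem reflTransGen_top_of_pow_mem
    (h5 : ∀ y : V, ((act V T - 1 : Module.End ℚ V) ^ 5) y = 0) (n : ℕ)
    {W : Submodule (MonoidAlgebra ℚ SL(2, ℤ)) V}
    (h : ∀ y : V, ((act V T - 1 : Module.End ℚ V) ^ n) y ∈ W) :
    Relation.ReflTransGen IsSymFactor W ⊤ := by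
  induction n generalizing W with
  | zero =>
    obtain rfl : W = ⊤ := eq_top_iff.2 fun y _ => h y
    exact .refl
  | succ n ih =>
    refine (reflTransGen_symTower W).trans (ih fun y => mem_symTower ?_ h5)
    have := h y
    rwa [pow_succ', Module.End.mul_apply] at this

end

end SL2Series

end

/-! ### The theorem -/

theorem theorem1 (V : Type*) [AddCommGroup V] [Module (MonoidAlgebra ℚ SL(2, ℤ)) V]
    (hV : ∀ u : SL(2, ℤ), IsNilpotent ((u : Matrix (Fin 2) (Fin 2) ℤ) - 1) →
      (Module.toAddMonoidEnd (MonoidAlgebra ℚ SL(2, ℤ)) V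
        (MonoidAlgebra.of ℚ SL(2, ℤ) u) - 1) ^ 5 = 0) :
    ∃ (m : ℕ) (W : Fin (m + 1) → Submodule (MonoidAlgebra ℚ SL(2, ℤ)) V),
      StrictMono W ∧ W 0 = ⊥ ∧ W (Fin.last m) = ⊤ ∧
        ∀ j : Fin m, ∃ k : ℕ, k ≤ 4 ∧
          SL2Series.IsDirectSumOfCopies (MonoidAlgebra ℚ SL(2, ℤ)) (SL2Series.SymQ k)
            (W j.succ ⧸ (W j.castSucc).submoduleOf (W j.succ)) := by
  -- The rational structure is the one restricted from the group algebra, which makes the scalar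
  -- tower compatible.
  let _ : Module ℚ V := Module.compHom V (algebraMap ℚ (MonoidAlgebra ℚ SL(2, ℤ)))
  have _ : IsScalarTower ℚ (MonoidAlgebra ℚ SL(2, ℤ)) V :=
    ⟨fun c a v => by rw [Algebra.smul_def, mul_smul]; rfl⟩
  have hnil : IsNilpotent ((ModularGroup.T : Matrix (Fin 2) (Fin 2) ℤ) - 1) := by
    refine ⟨2, ?_⟩
    rw [ModularGroup.coe_T, pow_two]
    ext i j
    fin_cases i <;> fin_cases j <;> simp [Matrix.mul_apply, Fin.sum_univ_two]
  have hT := hV ModularGroup.T hnil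
  rw [← map_one (Module.toAddMonoidEnd (MonoidAlgebra ℚ SL(2, ℤ)) V), ← map_sub, ← map_pow] at hT
  have h5 : ∀ y : V, ((SL2Series.act V ModularGroup.T - 1 : Module.End ℚ V) ^ 5) y = 0 := by
    intro y
    have e : (SL2Series.act V ModularGroup.T - 1 : Module.End ℚ V) =
        Algebra.lsmul ℚ ℚ V (MonoidAlgebra.of ℚ SL(2, ℤ) ModularGroup.T - 1) := by
      rw [map_sub, map_one]
      rfl
    rw [e, ← map_pow]
    exact DFunLike.congr_fun hT y
  obtain ⟨m, U, h0, h1, hU⟩ := SL2Series.exists_series_of_reflTransGen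
    (SL2Series.reflTransGen_top_of_pow_mem h5 5 (W := ⊥) fun y => by rw [h5]; exact zero_mem _)
  exact ⟨m, U, Fin.strictMono_iff_lt_succ.2 fun j => (hU j).1, h0, h1, fun j => (hU j).2⟩
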